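/- Let $n \ge 1$ and let $\mathbf{e} = (\mathbf{e}_1,\dots,\mathbf{e}_n)$, where each $\mathbf{e}_j \colon [-1,1] \to S^{n-1} \subset \mathbb{R}^n$ is a smooth curve in the unit sphere, and suppose that there is a constant $c>0$ such that $$|\mathbf{e}_1(s) \wedge \dots \wedge \mathbf{e}_n(s)| = |\det(\mathbf{e}_1(s),\dots,\mathbf{e}_n(s))| \ge c \quad \text{for all } s \in [-1,1].$$ For $\mathbf{r} = (r_1,\dots,r_n) \in (0,\infty)^n$ and $s \in [-1,1]$ define the parallelepiped $$T_{\mathbf{e},\mathbf{r}}(s) := \Big\{ \sum_{j=1}^n \lambda_j \mathbf{e}_j(s) : \lambda_j \in [-r_j^{-1}, r_j^{-1}] \text{ for } 1 \le j \le n \Big\},$$ and, for $f \in L^1_{\mathrm{loc}}(\mathbb{R}^n)$ complex-valued, the averages and the Nikodym maximal function $$\mathcal{A}_{\mathbf{e},\mathbf{r}} f(x;s) := \frac{1}{|T_{\mathbf{e},\mathbf{r}}(s)|}\int_{T_{\mathbf{e},\mathbf{r}}(s)} f(x-y)\,dy, \qquad \mathcal{N}_{\mathbf{e},\mathbf{r}}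 f(x) := \sup_{s \in [-1,1]} |\mathcal{A}_{\mathbf{e},\mathbf{r}} f(x;s)|.$$ Let $\mathrm{ecc}(\mathbf{r}) := \max_j r_j / \min_j r_j \ge 1$. Then for every $\varepsilon > 0$ there is a constant $C > 0$, depending only on $n$, $\mathbf{e}$ and $\varepsilon$, such that for all $\mathbf{r} \in (0,\infty)^n$ and all $f \in L^2(\mathbb{R}^n)$ one has $\mathcal{N}_{\mathbf{e},\mathbf{r}} f \in L^2(\mathbb{R}^n)$ and $$\|\mathcal{N}_{\mathbf{e},\mathbf{r}} f\|_{L^2(\mathbb{R}^n)} \le C\, \mathrm{ecc}(\mathbf{r})^{\varepsilon}\, \|f\|_{L^2(\mathbb{R}^n)}.$$ -/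

import Mathlib

open MeasureTheory Set
open scoped ENNReal ContDiff

noncomputable section

/-- A tuple `e = (e₁, …, eₙ)` of curves `e j : [-1,1] → S^{n-1}` that are smooth and uniformly
non-degenerate: `|e₁(s) ∧ ⋯ ∧ eₙ(s)| ≥ c > 0` on `[-1,1]`. The norm of the `n`-fold wedge product
of vectors of `ℝⁿ` is the absolute value of the determinant of the matrix with these columns.
Only the values of `e j` on `[-1,1]` are relevant. -/
structure IsNondegenerateFrame {n : ℕ} (e : Fin n → ℝ → EuclideanSpace ℝ (Fin n)) : Prop where
  smooth : ∀ j, ContDiffOn ℝ ∞ (e j) (Icc (-1) 1)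
  unit : ∀ j, ∀ s ∈ Icc (-1 : ℝ) 1, ‖e j s‖ = 1
  nondegenerate : ∃ c : ℝ, 0 < c ∧
    ∀ s ∈ Icc (-1 : ℝ) 1, c ≤ |(Matrix.of fun i j : Fin n => e j s i).det|

/-- The parallelepiped of all `∑ j, λ j • e j s` with `λ j ∈ [-(r j)⁻¹, (r j)⁻¹]`. -/
def nikodymBox {n : ℕ} (e : Fin n → ℝ → EuclideanSpace ℝ (Fin n)) (r : Fin n → ℝ) (s : ℝ) :
    Set (EuclideanSpace ℝ (Fin n)) :=
  {x | ∃ l : Fin n → ℝ, (∀ j, l j ∈ Icc (-(r j)⁻¹) ((r j)⁻¹)) ∧ x = ∑ j, l j • e j s}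

/-- The average of `y ↦ f (x - y)` over the parallelepiped at parameter `s`. -/
def nikodymAverage {n : ℕ} (e : Fin n → ℝ → EuclideanSpace ℝ (Fin n)) (r : Fin n → ℝ)
    (f : EuclideanSpace ℝ (Fin n) → ℂ) (x : EuclideanSpace ℝ (Fin n)) (s : ℝ) : ℂ :=
  ⨍ y in nikodymBox e r s, f (x - y) ∂volume

/-- The Nikodym maximal function `sup_{s ∈ [-1,1]} |𝒜 f(x; s)|`, with values in `[0, ∞]`. -/
def nikodymMaximal {n : ℕ} (e : Fin n → ℝ → EuclideanSpace ℝ (Fin n)) (r : Fin n → ℝ)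
    (f : EuclideanSpace ℝ (Fin n) → ℂ) (x : EuclideanSpace ℝ (Fin n)) : ℝ≥0∞ :=
  ⨆ s ∈ Icc (-1 : ℝ) 1, ‖nikodymAverage e r f x s‖ₑ

/-- The eccentricity `max_j r_j / min_j r_j`. -/
def eccentricity {n : ℕ} (r : Fin n → ℝ) : ℝ := (⨆ j, r j) / (⨅ j, r j)

end

/-! Each box average is dominated by the convolution of |f| with an L¹-normalised Gaussian adapted
to the box. The Gaussian may belong to any parameter t with |s - t| ≲ 1/ecc(r), because such a shift
moves box coordinates by at most 1 (`exists_inv_volume_le_gaussianKernel`). So a dyadic net of 2^L ~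
ecc(r) parameters suffices.

On such a net the maximum is controlled by the square function of the increments over L dyadic
scales (`sq_norm_le_dyadic_square_sum`). By Plancherel its L² norm is governed, for each frequency
ξ, by sums of squared multiplier increments, and these are at most the squared total variation in s.
The loss is (L + 1) times the variation (`lintegral_iSup_convolution_le`), and L is only logarithmic
in ecc(r).

It remains to bound the variation of exp(-q(s)), q(s) = π|B(s)ᵀξ|², by O(ecc^ε) uniformly in ξ,
where B(s) maps the unit cube onto the box. Write R = max r, ρ = min r. Nondegeneracy gives q ≥ K
with K ~ |ξ|²/R², while each derivative of q is O(|ξ|²/ρ²). With M ≥ 2/ε and intervals of length δ ~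
ecc^{-ε} this yields δ^M |q^(M+1)| ≤ K. Descending through the derivatives, each almost one-signed
derivative allows a single split point below which and above which the previous derivative is almost
one-signed. At the bottom ±q' ≥ -q, and q exp(-q) ≤ 1 bounds the variation on each interval by
O_M(1) (`eVariationOn_exp_neg_le_of_deriv_ge`). Adding over the ~ ecc^ε intervals finishes the
estimate. -/

open scoped FourierTransform Convolution

/-! ### Plancherel and square functions of convolution operators. -/

section Plancherel

variable {V : Type*} [NormedAddCommGroup V] [InnerProductSpace ℝ V] [FiniteDimensional ℝ V]
  [MeasurableSpace V] [BorelSpace V]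

theorem lintegral_enorm_sq_eq_ofReal {f : V → ℂ} (hf : Integrable fun x => ‖f x‖ ^ 2) :
    ∫⁻ x, ‖f x‖ₑ ^ 2 = ENNReal.ofReal (∫ x, ‖f x‖ ^ 2) := by
  rw [ofReal_integral_eq_lintegral_ofReal hf (.of_forall fun x => by positivity)]
  refine lintegral_congr fun x => ?_
  rw [ENNReal.ofReal_pow (norm_nonneg _), ofReal_norm]

theorem integrable_norm_sq_of_bounded {f : V → ℂ} (hf : Integrable f) {C : ℝ}
    (hC : ∀ x, ‖f x‖ ≤ C) : Integrable fun x => ‖f x‖ ^ 2 := by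
  simp_rw [pow_two]
  exact hf.norm.bdd_mul (c := C) hf.norm.aestronglyMeasurable (.of_forall fun x => by simpa using hC x)

/-- The sesquilinear pairing moves one transform onto the other factor as an inverse transform, and
Fourier inversion recovers f there. -/
theorem integral_norm_sq_fourier_of_integrable {f : V → ℂ} (hc : Continuous f)
    (hf : Integrable f) (hF : Integrable (𝓕 f)) :
    ∫ ξ, ‖𝓕 f ξ‖ ^ 2 = ∫ x, ‖f x‖ ^ 2 := by
  have key := VectorFourier.integral_sesq_fourierIntegral_eq_neg_flip (innerSL ℂ (E := ℂ))
    (μ := (volume : Measure V)) (ν := (volume : Measure V))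
    (L := innerₗ V) Real.continuous_fourierChar continuous_inner hf hF
  have h1 : (VectorFourier.fourierIntegral Real.fourierChar volume (-(innerₗ V).flip) (𝓕 f)) = f := by
    rw [flip_innerₗ]
    exact hc.fourierInv_fourier_eq hf hF
  rw [h1] at key
  have h2 : ∀ z : ℂ, innerSL ℂ z z = ((‖z‖ ^ 2 : ℝ) : ℂ) := fun z => by
    rw [innerSL_apply_apply, inner_self_eq_norm_sq_to_K]
    norm_cast
  have h3 : ∫ ξ, innerSL ℂ (𝓕 f ξ) (𝓕 f ξ) = ∫ x, innerSL ℂ (f x) (f x) := key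
  simp_rw [h2] at h3
  have h4 : ∫ ξ, ((‖𝓕 f ξ‖ ^ 2 : ℝ) : ℂ) = ∫ x, ((‖f x‖ ^ 2 : ℝ) : ℂ) := h3
  rw [integral_complex_ofReal, integral_complex_ofReal] at h4
  exact Complex.ofReal_injective h4

/-- Plancherel's theorem for continuous integrable functions with integrable Fourier transform. -/
theorem lintegral_enorm_sq_fourier {f : V → ℂ} (hc : Continuous f)
    (hf : Integrable f) (hF : Integrable (𝓕 f)) :
    ∫⁻ x, ‖f x‖ₑ ^ 2 = ∫⁻ ξ, ‖𝓕 f ξ‖ₑ ^ 2 := by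
  have h1 : ∀ x, ‖f x‖ ≤ ∫ ξ, ‖𝓕 f ξ‖ := fun x => by
    rw [← congrFun (hc.fourierInv_fourier_eq hf hF) x]
    exact VectorFourier.norm_fourierIntegral_le_integral_norm _ _ _ _ _
  have h2 : ∀ ξ, ‖𝓕 f ξ‖ ≤ ∫ x, ‖f x‖ := fun x =>
    VectorFourier.norm_fourierIntegral_le_integral_norm _ _ _ _ _
  rw [lintegral_enorm_sq_eq_ofReal (integrable_norm_sq_of_bounded hf h1),
    lintegral_enorm_sq_eq_ofReal (integrable_norm_sq_of_bounded hF h2),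
    integral_norm_sq_fourier_of_integrable hc hf hF]

/-- Integrability of K makes its transform bounded, so the product with the Schwartz function's
transform is integrable and Plancherel applies to K ⋆ h. -/
theorem lintegral_enorm_sq_convolution {K : V → ℂ} (hK : Integrable K) (h : SchwartzMap V ℂ) :
    ∫⁻ x, ‖∫ y, K y * h (x - y)‖ₑ ^ 2 = ∫⁻ ξ, ‖𝓕 K ξ‖ₑ ^ 2 * ‖𝓕 (h : V → ℂ) ξ‖ₑ ^ 2 := by
  have hb : BddAbove (range fun x => ‖h x‖) :=
    ⟨_, by rintro _ ⟨x, rfl⟩; exact h.toBoundedContinuousFunction.norm_coe_le_norm x⟩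
  have hc : Continuous (K ⋆[ContinuousLinearMap.mul ℂ ℂ] h) :=
    hb.continuous_convolution_right_of_integrable _ hK h.continuous
  have hi : Integrable (K ⋆[ContinuousLinearMap.mul ℂ ℂ] h) :=
    hK.integrable_convolution _ h.integrable
  have hF : 𝓕 (K ⋆[ContinuousLinearMap.mul ℂ ℂ] h) = fun ξ => 𝓕 K ξ * 𝓕 (h : V → ℂ) ξ :=
    funext fun ξ => Real.fourier_mul_convolution_eq hK h.integrable ξ
  have hFc : Continuous (𝓕 K) := VectorFourier.fourierIntegral_continuous
    Real.continuous_fourierChar continuous_inner hK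
  have hFi : Integrable (𝓕 (K ⋆[ContinuousLinearMap.mul ℂ ℂ] h)) := by
    rw [hF]
    have := (𝓕 h).integrable (μ := (volume : Measure V))
    rw [SchwartzMap.fourier_coe] at this
    exact this.bdd_mul (c := ∫ x, ‖K x‖) hFc.aestronglyMeasurable
      (.of_forall fun ξ => VectorFourier.norm_fourierIntegral_le_integral_norm _ _ _ _ _)
  have := lintegral_enorm_sq_fourier hc hi hFi
  rw [hF] at this
  simpa only [enorm_mul, mul_pow, convolution, ContinuousLinearMap.mul_apply'] using this

theorem SchwartzMap.lintegral_enorm_sq_fourier (h : SchwartzMap V ℂ) :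
    ∫⁻ ξ, ‖𝓕 (h : V → ℂ) ξ‖ₑ ^ 2 = ∫⁻ x, ‖h x‖ₑ ^ 2 := by
  refine (_root_.lintegral_enorm_sq_fourier h.continuous h.integrable ?_).symm
  rw [← SchwartzMap.fourier_coe]
  exact (𝓕 h).integrable

theorem lintegral_sum_enorm_sq_convolution_schwartz {ι : Type*} (I : Finset ι) {K : ι → V → ℂ}
    (hK : ∀ i ∈ I, Integrable (K i)) {A : ℝ≥0∞} (hA : ∀ ξ, ∑ i ∈ I, ‖𝓕 (K i) ξ‖ₑ ^ 2 ≤ A)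
    (h : SchwartzMap V ℂ) :
    ∫⁻ x, ∑ i ∈ I, ‖∫ y, K i y * h (x - y)‖ₑ ^ 2 ≤ A * ∫⁻ x, ‖h x‖ₑ ^ 2 := by
  have hb : BddAbove (range fun x => ‖h x‖) :=
    ⟨_, by rintro _ ⟨x, rfl⟩; exact h.toBoundedContinuousFunction.norm_coe_le_norm x⟩
  have hhc : Continuous (𝓕 (h : V → ℂ)) := by
    rw [← SchwartzMap.fourier_coe]; exact (𝓕 h).continuous
  rw [lintegral_finsetSum']
  · rw [Finset.sum_congr rfl fun i hi => lintegral_enorm_sq_convolution (hK i hi) h,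
      ← lintegral_finsetSum', ← SchwartzMap.lintegral_enorm_sq_fourier, ← lintegral_const_mul]
    · refine lintegral_mono fun ξ => ?_
      rw [← Finset.sum_mul]
      gcongr
      exact hA ξ
    · exact (hhc.enorm.measurable.pow_const 2)
    · intro i hi
      have hFc : Continuous (𝓕 (K i)) := VectorFourier.fourierIntegral_continuous
        Real.continuous_fourierChar continuous_inner (hK i hi)
      exact ((hFc.enorm.measurable.pow_const 2).mul (hhc.enorm.measurable.pow_const 2)).aemeasurable
  · intro i hi
    have hc : Continuous (K i ⋆[ContinuousLinearMap.mul ℂ ℂ] h) :=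
      hb.continuous_convolution_right_of_integrable _ (hK i hi) h.continuous
    exact (hc.enorm.measurable.pow_const 2).aemeasurable

theorem measurePreserving_sub_left' (x : V) :
    MeasurePreserving (fun y : V => x - y) volume volume := by
  simpa [sub_eq_add_neg, Function.comp_def] using
    (measurePreserving_add_left volume x).comp (Measure.measurePreserving_neg volume)

theorem lintegral_enorm_mul_sub_le {K f : V → ℂ} (hK : MemLp K 2) (hf : MemLp f 2) (x : V) :
    ∫⁻ y, ‖K y * f (x - y)‖ₑ ≤ eLpNorm K 2 volume * eLpNorm f 2 volume := by
  have hm : MemLp (fun y => f (x - y)) 2 volume :=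
    hf.comp_measurePreserving (measurePreserving_sub_left' x)
  have he : eLpNorm (fun y => f (x - y)) 2 volume = eLpNorm f 2 volume :=
    eLpNorm_comp_measurePreserving hf.1 (measurePreserving_sub_left' x)
  have := eLpNorm_smul_le_mul_eLpNorm (p := 2) (q := 2) (r := 1) hm.1 hK.1
  rw [he] at this
  simpa only [eLpNorm_one_eq_lintegral_enorm, Pi.mul_apply, smul_eq_mul] using this

theorem integrable_mul_sub {K f : V → ℂ} (hK : MemLp K 2) (hf : MemLp f 2) (x : V) :
    Integrable fun y => K y * f (x - y) :=
  hK.integrable_mul (hf.comp_measurePreserving (measurePreserving_sub_left' x))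

theorem eLpNorm_two_sq {f : V → ℂ} : eLpNorm f 2 volume ^ 2 = ∫⁻ x, ‖f x‖ₑ ^ 2 := by
  rw [eLpNorm_eq_lintegral_rpow_enorm_toReal (by norm_num) (by norm_num), ← ENNReal.rpow_natCast,
    ← ENNReal.rpow_mul]
  norm_num

theorem exists_schwartz_seq_tendsto {f : V → ℂ} (hf : MemLp f 2) :
    ∃ h : ℕ → SchwartzMap V ℂ,
      Filter.Tendsto (fun k => eLpNorm (f - ⇑(h k)) 2 volume) Filter.atTop (nhds 0) := by
  have : ∀ k : ℕ, ∃ h : SchwartzMap V ℂ,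
      eLpNorm (f - ⇑h) 2 volume ≤ ENNReal.ofReal (1 / ((k : ℝ) + 1)) := fun k => by
    obtain ⟨g, h1, h2, h3⟩ := MemLp.exist_eLpNorm_sub_le (p := 2) (by norm_num) (by norm_num) hf
      (ε := 1 / ((k : ℝ) + 1)) (by positivity)
    exact ⟨h1.toSchwartzMap h2, h3⟩
  choose h hh using this
  refine ⟨h, tendsto_of_tendsto_of_tendsto_of_le_of_le tendsto_const_nhds ?_
    (fun _ => zero_le) hh⟩
  simpa using ENNReal.tendsto_ofReal tendsto_one_div_add_atTop_nhds_zero_nat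

/-- `L²` bound for the square function of finitely many convolution operators. -/
theorem lintegral_sum_enorm_sq_convolution_le {ι : Type*} (I : Finset ι) {K : ι → V → ℂ}
    (hK : ∀ i ∈ I, Integrable (K i)) (hK2 : ∀ i ∈ I, MemLp (K i) 2)
    {A : ℝ≥0∞} (hAtop : A ≠ ⊤) (hA : ∀ ξ, ∑ i ∈ I, ‖𝓕 (K i) ξ‖ₑ ^ 2 ≤ A) {f : V → ℂ}
    (hf : MemLp f 2) :
    ∫⁻ x, ∑ i ∈ I, ‖∫ y, K i y * f (x - y)‖ₑ ^ 2 ≤ A * eLpNorm f 2 volume ^ 2 := by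
  obtain ⟨h, hh⟩ := exists_schwartz_seq_tendsto hf
  have hm : ∀ k, MemLp (h k) 2 (volume : Measure V) := fun k => (h k).memLp 2 volume
  -- By Cauchy–Schwarz, L² convergence of the Schwartz approximants gives convergence of each
  -- convolution at every point. This is why the kernels are required to be in L² as well as L¹.
  have hlim : ∀ x, ∀ i ∈ I, Filter.Tendsto (fun k => ∫ y, K i y * h k (x - y)) Filter.atTop
      (nhds (∫ y, K i y * f (x - y))) := by
    intro x i hi
    rw [tendsto_iff_edist_tendsto_0]
    have h0 : Filter.Tendsto (fun k => eLpNorm (K i) 2 volume * eLpNorm (f - ⇑(h k)) 2 volume)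
        Filter.atTop (nhds 0) := by
      simpa using ENNReal.Tendsto.const_mul hh (.inr (hK2 i hi).2.ne)
    refine tendsto_of_tendsto_of_tendsto_of_le_of_le tendsto_const_nhds h0 (fun _ => zero_le)
      fun k => ?_
    dsimp only
    rw [edist_comm, edist_eq_enorm_sub,
      ← integral_sub (integrable_mul_sub (hK2 i hi) hf x) (integrable_mul_sub (hK2 i hi) (hm k) x)]
    refine (enorm_integral_le_lintegral_enorm _).trans ?_
    refine le_trans (le_of_eq ?_) (lintegral_enorm_mul_sub_le (hK2 i hi) (hf.sub (hm k)) x)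
    simp [mul_sub]
  have hnorm : Filter.Tendsto (fun k => A * eLpNorm (h k) 2 volume ^ 2) Filter.atTop
      (nhds (A * eLpNorm f 2 volume ^ 2)) := by
    refine ENNReal.Tendsto.const_mul (ENNReal.Tendsto.pow ?_) (.inr hAtop)
    refine tendsto_of_tendsto_of_tendsto_of_le_of_le
      (g := fun k => eLpNorm f 2 volume - eLpNorm (f - ⇑(h k)) 2 volume)
      (h := fun k => eLpNorm f 2 volume + eLpNorm (f - ⇑(h k)) 2 volume) ?_ ?_ (fun k => ?_) fun k => ?_
    · simpa using ENNReal.Tendsto.sub tendsto_const_nhds hh (.inl hf.2.ne)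
    · simpa using hh.const_add (eLpNorm f 2 volume)
    · dsimp only
      rw [tsub_le_iff_left]
      have := eLpNorm_add_le (μ := volume) (p := 2) (hf.sub (hm k)).1 (hm k).1 (by norm_num)
      simpa using this
    · dsimp only
      have := eLpNorm_sub_le (μ := volume) (p := 2) hf.1 (hf.sub (hm k)).1 (by norm_num)
      simpa using this
  have hpt : ∀ x, ∑ i ∈ I, ‖∫ y, K i y * f (x - y)‖ₑ ^ 2 =
      Filter.liminf (fun k => ∑ i ∈ I, ‖∫ y, K i y * h k (x - y)‖ₑ ^ 2) Filter.atTop := fun x => by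
    refine (Filter.Tendsto.liminf_eq ?_).symm
    exact tendsto_finsetSum _ fun i hi =>
      ENNReal.Tendsto.pow ((continuous_enorm.tendsto _).comp (hlim x i hi))
  simp_rw [hpt]
  -- Fatou's lemma carries the Schwartz estimate over to f.
  refine (lintegral_liminf_le fun k => ?_).trans ?_
  · refine Finset.measurable_sum _ fun i hi => ?_
    have hb : BddAbove (range fun x => ‖h k x‖) :=
      ⟨_, by rintro _ ⟨x, rfl⟩; exact (h k).toBoundedContinuousFunction.norm_coe_le_norm x⟩
    have hc : Continuous (K i ⋆[ContinuousLinearMap.mul ℂ ℂ] h k) :=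
      hb.continuous_convolution_right_of_integrable _ (hK i hi) (h k).continuous
    exact hc.enorm.measurable.pow_const 2
  · rw [← hnorm.liminf_eq]
    refine Filter.liminf_le_liminf (.of_forall fun k => ?_)
    rw [eLpNorm_two_sq]
    exact lintegral_sum_enorm_sq_convolution_schwartz I hK hA (h k)

end Plancherel

/-! ### Gaussians adapted to a linear image of the ball. -/

section GaussianKernel

variable {V : Type*} [NormedAddCommGroup V] [InnerProductSpace ℝ V]

/-- The `L¹`-normalised Gaussian adapted to the image of the unit ball under `B`. -/
noncomputable def gaussianKernel (B : V ≃L[ℝ] V) (x : V) : ℝ :=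
  |LinearMap.det (B : V →ₗ[ℝ] V)|⁻¹ * Real.exp (-Real.pi * ‖B.symm x‖ ^ 2)

theorem abs_det_pos (B : V ≃L[ℝ] V) : 0 < |LinearMap.det (B : V →ₗ[ℝ] V)| :=
  abs_pos.2 (LinearEquiv.isUnit_det' B.toLinearEquiv).ne_zero

theorem gaussianKernel_nonneg (B : V ≃L[ℝ] V) (x : V) : 0 ≤ gaussianKernel B x := by
  unfold gaussianKernel
  positivity

theorem gaussianKernel_le (B : V ≃L[ℝ] V) (x : V) :
    gaussianKernel B x ≤ |LinearMap.det (B : V →ₗ[ℝ] V)|⁻¹ := by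
  unfold gaussianKernel
  refine mul_le_of_le_one_right (by positivity) (Real.exp_le_one_iff.2 ?_)
  have := Real.pi_pos
  nlinarith [sq_nonneg ‖B.symm x‖]

variable [FiniteDimensional ℝ V] [MeasurableSpace V] [BorelSpace V]

theorem map_volume_equiv (B : V ≃L[ℝ] V) :
    Measure.map B (volume : Measure V) =
      ENNReal.ofReal |(LinearMap.det (B : V →ₗ[ℝ] V))⁻¹| • volume :=
  Measure.map_linearMap_addHaar_eq_smul_addHaar volume (abs_pos.1 (abs_det_pos B))

theorem integral_comp_equiv (B : V ≃L[ℝ] V) (g : V → ℂ) :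
    ∫ u, g (B u) = ((|LinearMap.det (B : V →ₗ[ℝ] V)|⁻¹ : ℝ) : ℂ) * ∫ v, g v := by
  have h1 := B.toHomeomorph.measurableEmbedding.integral_map (μ := volume) g
  have h : Measure.map (B.toHomeomorph) (volume : Measure V) =
      ENNReal.ofReal |(LinearMap.det (B : V →ₗ[ℝ] V))⁻¹| • volume := map_volume_equiv B
  rw [h, integral_smul_measure, ENNReal.toReal_ofReal (abs_nonneg _), abs_inv,
    Complex.real_smul] at h1
  exact h1.symm

theorem integrable_gaussianKernel (B : V ≃L[ℝ] V) :
    Integrable fun x => (gaussianKernel B x : ℂ) := by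
  have h1 : Integrable fun v : V => Complex.exp (-Real.pi * ‖v‖ ^ 2) := by
    have := GaussianFourier.integrable_cexp_neg_mul_sq_norm_add (V := V) (b := Real.pi)
      (by simpa using Real.pi_pos) 0 0
    simpa using this
  have h2 : Integrable (fun x => (gaussianKernel B x : ℂ)) (Measure.map B.toHomeomorph volume) := by
    rw [B.toHomeomorph.measurableEmbedding.integrable_map_iff]
    refine (h1.const_mul ((|LinearMap.det (B : V →ₗ[ℝ] V)|⁻¹ : ℝ) : ℂ)).congr (.of_forall fun v => ?_)
    simp [gaussianKernel]
  have h : Measure.map (B.toHomeomorph) (volume : Measure V) =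
      ENNReal.ofReal |(LinearMap.det (B : V →ₗ[ℝ] V))⁻¹| • volume := map_volume_equiv B
  rw [h] at h2
  refine (integrable_smul_measure ?_ ENNReal.ofReal_ne_top).1 h2
  rw [abs_inv]
  exact (ENNReal.ofReal_pos.2 (inv_pos.2 (abs_det_pos B))).ne'

theorem memLp_two_gaussianKernel (B : V ≃L[ℝ] V) :
    MemLp (fun x => (gaussianKernel B x : ℂ)) 2 volume := by
  rw [memLp_two_iff_integrable_sq_norm (integrable_gaussianKernel B).1]
  refine integrable_norm_sq_of_bounded (integrable_gaussianKernel B)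
    (C := |LinearMap.det (B : V →ₗ[ℝ] V)|⁻¹) fun x => ?_
  rw [Complex.norm_real, Real.norm_of_nonneg (gaussianKernel_nonneg B x)]
  exact gaussianKernel_le B x

/-- The substitution x = B u turns the kernel into the standard Gaussian, which is its own
transform, and moves B to its adjoint acting on the frequency. -/
theorem fourier_gaussianKernel (B : V ≃L[ℝ] V) (w : V) :
    𝓕 (fun x => (gaussianKernel B x : ℂ)) w =
      (Real.exp (-Real.pi * ‖ContinuousLinearMap.adjoint (B : V →L[ℝ] V) w‖ ^ 2) : ℂ) := by
  have h1 := fourier_gaussian_innerProductSpace (V := V) (b := Real.pi)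
      (by simpa using Real.pi_pos) (ContinuousLinearMap.adjoint (B : V →L[ℝ] V) w)
  have hpi : (Real.pi : ℂ) ≠ 0 := by exact_mod_cast Real.pi_ne_zero
  rw [div_self hpi, Complex.one_cpow, one_mul] at h1
  have h2 : 𝓕 (fun v : V => Complex.exp (-Real.pi * ‖v‖ ^ 2))
        (ContinuousLinearMap.adjoint (B : V →L[ℝ] V) w) =
      𝓕 (fun x => (gaussianKernel B x : ℂ)) w := by
    rw [Real.fourier_eq, Real.fourier_eq]
    have := integral_comp_equiv B
      (fun v => 𝐞 (-inner ℝ v w) • Complex.exp (-Real.pi * ‖B.symm v‖ ^ 2))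
    refine Eq.trans (integral_congr_ae (.of_forall fun u => ?_))
      (this.trans ((integral_const_mul _ _).symm.trans (integral_congr_ae (.of_forall fun v => ?_))))
    · simp [ContinuousLinearMap.adjoint_inner_right]
    · simp only [gaussianKernel, Circle.smul_def, smul_eq_mul]
      push_cast
      ring
  rw [← h2, h1]
  push_cast
  congr 1
  field_simp

end GaussianKernel

/-! ### Chaining along dyadic scales. -/

section DyadicChaining

/-- Dyadic chaining along `0 ≤ k < 2 ^ L`. -/
theorem norm_le_dyadic_chain {E : Type*} [SeminormedAddCommGroup E] (L : ℕ) :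
    ∀ (F : ℕ → E), ∀ k < 2 ^ L, ∃ d : ℕ → ℝ, ‖F k‖ ≤ ‖F 0‖ + ∑ l ∈ Finset.range L, d l ∧
      ∀ l ∈ Finset.range L, 0 ≤ d l ∧ d l ^ 2 ≤
        ∑ j ∈ Finset.range (2 ^ (L - l)), ‖F ((j + 1) * 2 ^ l) - F (j * 2 ^ l)‖ ^ 2 := by
  induction L with
  | zero =>
    intro F k hk
    obtain rfl : k = 0 := by simpa using hk
    exact ⟨0, by simp⟩
  | succ L ih =>
    intro F k hk
    have hk2 : k / 2 < 2 ^ L := by rw [pow_succ] at hk; omega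
    -- The hypothesis is applied to the even-indexed subsequence. The finest scale contributes only
    -- the step from 2(k/2) to k, which is zero when k is even.
    obtain ⟨d, hd, hd2⟩ := ih (fun i => F (2 * i)) (k / 2) hk2
    refine ⟨fun l => if l = 0 then ‖F k - F (2 * (k / 2))‖ else d (l - 1), ?_, ?_⟩
    · rw [Finset.sum_range_succ']
      simp only [Nat.add_eq_zero_iff, one_ne_zero, and_false, if_false, Nat.add_sub_cancel, if_true]
      have := norm_le_norm_add_norm_sub' (F k) (F (2 * (k / 2)))
      simp only [mul_zero] at hd
      linarith
    · intro l hl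
      rcases Nat.eq_zero_or_pos l with rfl | hl0
      · refine ⟨by simp, ?_⟩
        simp only [if_true, pow_zero, mul_one, Nat.sub_zero]
        rcases Nat.even_or_odd' k with ⟨c, rfl | rfl⟩
        · simp only [Nat.mul_div_cancel_left c two_pos, sub_self, norm_zero]
          rw [zero_pow two_ne_zero]
          positivity
        · have : (2 * c + 1) / 2 = c := by omega
          rw [this]
          exact Finset.single_le_sum (f := fun j => ‖F (j + 1) - F j‖ ^ 2)
            (fun _ _ => by positivity) (Finset.mem_range.2 (by omega : 2 * c < 2 ^ (L + 1)))
      · obtain ⟨m, rfl⟩ : ∃ m, l = m + 1 := ⟨l - 1, by omega⟩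
        have hm : m ∈ Finset.range L := by simpa using hl
        simp only [Nat.add_eq_zero_iff, one_ne_zero, and_false, if_false, Nat.add_sub_cancel]
        obtain ⟨h1, h2⟩ := hd2 m hm
        refine ⟨h1, h2.trans (le_of_eq ?_)⟩
        rw [Nat.add_sub_add_right]
        refine Finset.sum_congr rfl fun j _ => ?_
        congr 4 <;> ring

/-- The Rademacher–Menshov inequality in pointwise form. -/
theorem sq_norm_le_dyadic_square_sum {E : Type*} [SeminormedAddCommGroup E] (L : ℕ) (F : ℕ → E)
    {k : ℕ} (hk : k < 2 ^ L) :
    ‖F k‖ ^ 2 ≤ (L + 1) * (‖F 0‖ ^ 2 + ∑ l ∈ Finset.range L,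
      ∑ j ∈ Finset.range (2 ^ (L - l)), ‖F ((j + 1) * 2 ^ l) - F (j * 2 ^ l)‖ ^ 2) := by
  obtain ⟨d, hd, hd2⟩ := norm_le_dyadic_chain L F k hk
  have h1 : (‖F 0‖ + ∑ l ∈ Finset.range L, d l) ^ 2 ≤
      (L + 1) * (‖F 0‖ ^ 2 + ∑ l ∈ Finset.range L, d l ^ 2) := by
    -- Cauchy–Schwarz over L + 1 terms; index 0 of the auxiliary sequence holds the starting value.
    have := sq_sum_le_card_mul_sum_sq (s := Finset.range (L + 1))
      (f := fun i => if i = 0 then ‖F 0‖ else d (i - 1))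
    rw [Finset.sum_range_succ', Finset.sum_range_succ'] at this
    simp only [Nat.add_eq_zero_iff, one_ne_zero, and_false, if_false, Nat.add_sub_cancel,
      if_true, Finset.card_range] at this
    push_cast at this
    linarith
  refine (pow_le_pow_left₀ (norm_nonneg _) hd 2).trans (h1.trans ?_)
  gcongr with l hl
  exact (hd2 l hl).2

end DyadicChaining

/-! ### Maximal function over finitely many convolution operators. -/

section Maximal

variable {V : Type*} [NormedAddCommGroup V] [InnerProductSpace ℝ V] [FiniteDimensional ℝ V]
  [MeasurableSpace V] [BorelSpace V]

open scoped FourierTransform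

theorem fourier_sub_of_integrable {K H : V → ℂ} (hK : Integrable K) (hH : Integrable H) (ξ : V) :
    𝓕 (fun x => K x - H x) ξ = 𝓕 K ξ - 𝓕 H ξ := by
  rw [Real.fourier_eq, Real.fourier_eq, Real.fourier_eq,
    ← integral_sub ((Real.fourierIntegral_convergent_iff ξ).2 hK)
      ((Real.fourierIntegral_convergent_iff ξ).2 hH)]
  simp only [smul_sub]

/-- The maximal function of `2 ^ L` convolution operators whose multipliers have total variation
at most `A` is bounded on `L²`, with a logarithmic loss in the number of operators. -/
theorem lintegral_iSup_convolution_le (L : ℕ) {K : ℕ → V → ℂ} (hK : ∀ i, Integrable (K i))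
    (hK2 : ∀ i, MemLp (K i) 2) {A : ℝ} (hA : 1 ≤ A) (h0 : ∀ ξ, ‖𝓕 (K 0) ξ‖ ≤ 1)
    (hvar : ∀ ξ, ∀ l < L, ∑ j ∈ Finset.range (2 ^ (L - l)),
      ‖𝓕 (K ((j + 1) * 2 ^ l)) ξ - 𝓕 (K (j * 2 ^ l)) ξ‖ ≤ A) {f : V → ℂ} (hf : MemLp f 2) :
    ∫⁻ x, ⨆ k ∈ Finset.range (2 ^ L), ‖∫ y, K k y * f (x - y)‖ₑ ^ 2 ≤
      ENNReal.ofReal (((L + 1) * A) ^ 2) * eLpNorm f 2 volume ^ 2 := by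
  -- `none` indexes the starting operator, and a pair (l, j) indexes the j-th increment at scale l.
  let I : Finset (Option (Σ _ : ℕ, ℕ)) :=
    Finset.insertNone ((Finset.range L).sigma fun l => Finset.range (2 ^ (L - l)))
  let H : Option (Σ _ : ℕ, ℕ) → V → ℂ := fun i => i.elim (K 0)
    fun p => fun x => K ((p.2 + 1) * 2 ^ p.1) x - K (p.2 * 2 ^ p.1) x
  have hH : ∀ i ∈ I, Integrable (H i) := by
    rintro (_ | p) -
    · exact hK 0
    · exact (hK _).sub (hK _)
  have hH2 : ∀ i ∈ I, MemLp (H i) 2 := by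
    rintro (_ | p) -
    · exact hK2 0
    · exact (hK2 _).sub (hK2 _)
  have hsq : ∀ ξ, ∑ i ∈ I, ‖𝓕 (H i) ξ‖ ^ 2 ≤ (L + 1) * A ^ 2 := by
    intro ξ
    simp only [I, Finset.sum_insertNone, Finset.sum_sigma, H, Option.elim]
    have h1 : ‖𝓕 (K 0) ξ‖ ^ 2 ≤ A ^ 2 := by
      gcongr
      exact (h0 ξ).trans hA
    have h2 : ∀ l ∈ Finset.range L, ∑ j ∈ Finset.range (2 ^ (L - l)),
        ‖𝓕 (fun x => K ((j + 1) * 2 ^ l) x - K (j * 2 ^ l) x) ξ‖ ^ 2 ≤ A ^ 2 := by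
      intro l hl
      simp only [fourier_sub_of_integrable (hK _) (hK _)]
      -- Here ℓ² ≤ ℓ¹ lets total variation control the squared increments at one scale. Summing over
      -- scales costs one factor L + 1; the pointwise chaining costs the other.
      refine (Finset.sum_sq_le_sq_sum_of_nonneg fun _ _ => norm_nonneg _).trans ?_
      gcongr
      exact hvar ξ l (Finset.mem_range.1 hl)
    have h3 := Finset.sum_le_card_nsmul _ _ _ h2
    rw [Finset.card_range, nsmul_eq_mul] at h3
    linarith
  have hsq' : ∀ ξ, ∑ i ∈ I, ‖𝓕 (H i) ξ‖ₑ ^ 2 ≤ ENNReal.ofReal ((L + 1) * A ^ 2) := by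
    intro ξ
    refine le_trans (le_of_eq ?_) (ENNReal.ofReal_le_ofReal (hsq ξ))
    rw [ENNReal.ofReal_sum_of_nonneg fun _ _ => by positivity]
    refine Finset.sum_congr rfl fun i _ => ?_
    rw [ENNReal.ofReal_pow (norm_nonneg _), ofReal_norm]
  have main := lintegral_sum_enorm_sq_convolution_le I hH hH2 ENNReal.ofReal_ne_top hsq' hf
  have hpt : ∀ x, ⨆ k ∈ Finset.range (2 ^ L), ‖∫ y, K k y * f (x - y)‖ₑ ^ 2 ≤
      ENNReal.ofReal (L + 1) * ∑ i ∈ I, ‖∫ y, H i y * f (x - y)‖ₑ ^ 2 := by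
    intro x
    refine iSup₂_le fun k hk => ?_
    have h1 := sq_norm_le_dyadic_square_sum L (fun k => ∫ y, K k y * f (x - y))
      (Finset.mem_range.1 hk)
    have h2 : ∑ i ∈ I, ‖∫ y, H i y * f (x - y)‖ ^ 2 = ‖∫ y, K 0 y * f (x - y)‖ ^ 2 +
        ∑ l ∈ Finset.range L, ∑ j ∈ Finset.range (2 ^ (L - l)),
          ‖(∫ y, K ((j + 1) * 2 ^ l) y * f (x - y)) - ∫ y, K (j * 2 ^ l) y * f (x - y)‖ ^ 2 := by
      simp only [I, Finset.sum_insertNone, Finset.sum_sigma, H, Option.elim, sub_mul]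
      simp only [integral_sub (integrable_mul_sub (hK2 _) hf x) (integrable_mul_sub (hK2 _) hf x)]
    rw [← h2] at h1
    have h3 := ENNReal.ofReal_le_ofReal h1
    rw [ENNReal.ofReal_mul (by positivity), ENNReal.ofReal_sum_of_nonneg fun _ _ => by positivity,
      ENNReal.ofReal_pow (norm_nonneg _), ofReal_norm] at h3
    refine h3.trans (le_of_eq ?_)
    congr 1
    refine Finset.sum_congr rfl fun i _ => ?_
    rw [ENNReal.ofReal_pow (norm_nonneg _), ofReal_norm]
  refine (lintegral_mono hpt).trans ?_
  rw [lintegral_const_mul' _ _ ENNReal.ofReal_ne_top]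
  calc _ ≤ ENNReal.ofReal (L + 1) * (ENNReal.ofReal ((L + 1) * A ^ 2) * eLpNorm f 2 volume ^ 2) := by
        gcongr
    _ = _ := by
        rw [← mul_assoc, ← ENNReal.ofReal_mul (by positivity)]
        congr 2
        ring

end Maximal

/-! ### Total variation of exp(-Q). -/

section Variation

/-- An increment of m exceeds the decrease of σm by at most twice the step length, and this majorant
telescopes. -/
theorem eVariationOn_le_of_antitoneOn_sub_id {m : ℝ → ℝ} {a b : ℝ} (hab : a ≤ b) {σ : ℝ}
    (hσ : |σ| = 1) (h : AntitoneOn (fun s => σ * m s - s) (Icc a b)) :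
    eVariationOn m (Icc a b) ≤ ENNReal.ofReal (|m a - m b| + 2 * (b - a)) := by
  have key : ∀ x ∈ Icc a b, ∀ y ∈ Icc a b, x ≤ y →
      |m y - m x| ≤ (σ * m x - σ * m y) + 2 * (y - x) := by
    intro x hx y hy hxy
    have h1 := h hx hy hxy
    dsimp only at h1
    have h2 : |m y - m x| = |σ * m y - σ * m x| := by
      rw [← mul_sub, abs_mul, hσ, one_mul]
    rw [h2, abs_le]
    constructor <;> linarith
  refine iSup_le fun ⟨n, u, hu, us⟩ => ?_
  have h1 : ∀ i ∈ Finset.range n, edist (m (u (i + 1))) (m (u i)) ≤ ENNReal.ofReal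
      ((2 * u (i + 1) - σ * m (u (i + 1))) - (2 * u i - σ * m (u i))) := by
    intro i _
    rw [edist_dist, Real.dist_eq]
    refine ENNReal.ofReal_le_ofReal ?_
    have := key _ (us i) _ (us (i + 1)) (hu (Nat.le_succ i))
    linarith
  refine (Finset.sum_le_sum h1).trans ?_
  rw [← ENNReal.ofReal_sum_of_nonneg]
  · refine ENNReal.ofReal_le_ofReal ?_
    rw [Finset.sum_range_sub (fun i => 2 * u i - σ * m (u i))]
    have ha : a ∈ Icc a b := left_mem_Icc.2 hab
    have hb : b ∈ Icc a b := right_mem_Icc.2 hab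
    have h3 := h ha (us 0) (us 0).1
    have h4 := h (us n) hb (us n).2
    dsimp only at h3 h4
    have h5 : σ * m a - σ * m b ≤ |m a - m b| := by
      rw [← mul_sub]
      refine (le_abs_self _).trans ?_
      rw [abs_mul, hσ, one_mul]
    have h6 := (us n).2
    have h7 := (us 0).1
    linarith
  · intro i _
    have := key _ (us i) _ (us (i + 1)) (hu (Nat.le_succ i))
    have h0 := abs_nonneg (m (u (i + 1)) - m (u i))
    linarith

theorem antitoneOn_of_hasDerivWithinAt {f f' : ℝ → ℝ} {S : Set ℝ} {a b : ℝ}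
    (hS : Icc a b ⊆ S) (hf : ∀ s ∈ S, HasDerivWithinAt f (f' s) S s)
    (h : ∀ s ∈ Icc a b, f' s ≤ 0) : AntitoneOn f (Icc a b) :=
  antitoneOn_of_hasDerivWithinAt_nonpos (f' := f') (convex_Icc a b)
    (fun s hs => ((hf s (hS hs)).mono hS).continuousWithinAt)
    (fun s hs => (hf s (hS (interior_subset hs))).mono (interior_subset.trans hS))
    fun s hs => h s (interior_subset hs)

theorem monotoneOn_of_hasDerivWithinAt {f f' : ℝ → ℝ} {S : Set ℝ} {a b : ℝ}
    (hS : Icc a b ⊆ S) (hf : ∀ s ∈ S, HasDerivWithinAt f (f' s) S s)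
    (h : ∀ s ∈ Icc a b, 0 ≤ f' s) : MonotoneOn f (Icc a b) :=
  monotoneOn_of_hasDerivWithinAt_nonneg (f' := f') (convex_Icc a b)
    (fun s hs => ((hf s (hS hs)).mono hS).continuousWithinAt)
    (fun s hs => (hf s (hS (interior_subset hs))).mono (interior_subset.trans hS))
    fun s hs => h s (interior_subset hs)

/-- If a rescaled derivative of `Q` is essentially one-signed relative to a lower bound `K` of `Q`
on a short interval, then `exp (-Q)` has bounded variation there. -/
theorem eVariationOn_exp_neg_le_of_deriv_ge {Q : ℕ → ℝ → ℝ} {S : Set ℝ}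
    (hQ : ∀ j, ∀ s ∈ S, HasDerivWithinAt (Q j) (Q (j + 1) s) S s) {K δ : ℝ} (hK : 0 ≤ K)
    (hδ : 0 < δ) (hδ2 : δ ≤ 2) (hKQ : ∀ s ∈ S, K ≤ Q 0 s) (j : ℕ) :
    ∀ a b σ : ℝ, a ≤ b → b - a ≤ δ → Icc a b ⊆ S → |σ| = 1 →
      (∀ s ∈ Icc a b, -K ≤ σ * (δ ^ j * Q (j + 1) s)) →
      eVariationOn (fun s => Real.exp (-Q 0 s)) (Icc a b) ≤ ENNReal.ofReal (2 ^ j * 5) := by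
  induction j with
  | zero =>
    intro a b σ hab hbδ hS hσ h
    have hanti : AntitoneOn (fun s => σ * Real.exp (-Q 0 s) - s) (Icc a b) := by
      refine antitoneOn_of_hasDerivWithinAt hS
        (f' := fun s => σ * (Real.exp (-Q 0 s) * (-Q 1 s)) - 1)
        (fun s hs => (((hQ 0 s hs).neg.exp).const_mul σ).sub (hasDerivWithinAt_id s S)) ?_
      intro s hs
      have h1 := h s hs
      have h2 := hKQ s (hS hs)
      simp only [pow_zero, one_mul, zero_add] at h1
      -- Since σQ' ≥ -K ≥ -Q, the derivative of σ exp(-Q) is at most Q exp(-Q) ≤ 1.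
      have h3 : Q 0 s ≤ Real.exp (Q 0 s) := by linarith [Real.add_one_le_exp (Q 0 s)]
      have h4 : Real.exp (-Q 0 s) * Q 0 s ≤ 1 := by
        rw [Real.exp_neg, inv_mul_le_iff₀ (Real.exp_pos _)]
        linarith
      have h5 : Real.exp (-Q 0 s) * (-(σ * Q 1 s)) ≤ Real.exp (-Q 0 s) * Q 0 s :=
        mul_le_mul_of_nonneg_left (by linarith) (Real.exp_pos _).le
      linarith
    -- The constant is 5 = 1 + 2·2: the endpoint values lie in (0, 1], and the interval has length
    -- at most δ ≤ 2.
    refine (eVariationOn_le_of_antitoneOn_sub_id hab hσ hanti).trans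
      (ENNReal.ofReal_le_ofReal ?_)
    have h1 : ∀ s ∈ Icc a b, Real.exp (-Q 0 s) ≤ 1 := fun s hs =>
      Real.exp_le_one_iff.2 (by linarith [hKQ s (hS hs)])
    have h2 := h1 a (left_mem_Icc.2 hab)
    have h3 := h1 b (right_mem_Icc.2 hab)
    have h4 : |Real.exp (-Q 0 a) - Real.exp (-Q 0 b)| ≤ 1 := by
      rw [abs_le]
      constructor <;> linarith [Real.exp_pos (-Q 0 a), Real.exp_pos (-Q 0 b)]
    linarith
  | succ j ih =>
    intro a b σ hab hbδ hS hσ h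
    -- The linear term offsets the allowed negativity -K of the next derivative, so g is monotone.
    -- It stays between 0 and K on [a, b], so the sign of g still gives the lower bound -K one order
    -- down: with sign -σ where g ≤ 0, with sign σ where g ≥ 0.
    set g : ℝ → ℝ := fun s => σ * (δ ^ j * Q (j + 1) s) + K / δ * (s - a) with hg
    have hgd : ∀ s ∈ S, HasDerivWithinAt g (σ * (δ ^ j * Q (j + 2) s) + K / δ * 1) S s :=
      fun s hs => (((hQ (j + 1) s hs).const_mul _).const_mul _).add
        (((hasDerivWithinAt_id s S).sub_const a).const_mul _)
    have hmono : MonotoneOn g (Icc a b) := by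
      refine monotoneOn_of_hasDerivWithinAt hS hgd fun s hs => ?_
      have h1 := h s hs
      have h2 : σ * (δ ^ j * Q (j + 2) s) + K / δ * 1 =
          (σ * (δ ^ (j + 1) * Q (j + 1 + 1) s) + K) / δ := by
        field_simp
        ring_nf
      rw [h2]
      exact div_nonneg (by linarith) hδ.le
    have hgc : ContinuousOn g (Icc a b) :=
      fun s hs => ((hgd s (hS hs)).mono hS).continuousWithinAt
    have hneg : ∀ t ∈ Icc a b, g t ≤ 0 →
        eVariationOn (fun s => Real.exp (-Q 0 s)) (Icc a t) ≤ ENNReal.ofReal (2 ^ j * 5) := by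
      intro t ht hgt
      refine ih a t (-σ) ht.1 (by linarith [ht.2]) ((Icc_subset_Icc_right ht.2).trans hS)
        (by rwa [abs_neg]) fun s hs => ?_
      have h1 := hmono ⟨hs.1, hs.2.trans ht.2⟩ ht hs.2
      have h2 : 0 ≤ K / δ * (s - a) := mul_nonneg (by positivity) (by linarith [hs.1])
      simp only [hg] at h1 hgt
      linarith
    have hpos : ∀ t ∈ Icc a b, 0 ≤ g t →
        eVariationOn (fun s => Real.exp (-Q 0 s)) (Icc t b) ≤ ENNReal.ofReal (2 ^ j * 5) := by
      intro t ht hgt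
      refine ih t b σ ht.2 (by linarith [ht.1]) ((Icc_subset_Icc_left ht.1).trans hS)
        hσ fun s hs => ?_
      have h1 := hmono ht ⟨ht.1.trans hs.1, hs.2⟩ hs.1
      have h2 : K / δ * (s - a) ≤ K := by
        rw [div_mul_eq_mul_div, div_le_iff₀ hδ]
        exact mul_le_mul_of_nonneg_left (by linarith [hs.2]) hK
      simp only [hg] at h1 hgt
      linarith
    have hle : ENNReal.ofReal (2 ^ j * 5) ≤ ENNReal.ofReal (2 ^ (j + 1) * 5) :=
      ENNReal.ofReal_le_ofReal (by gcongr <;> norm_num)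
    rcases le_or_gt (g b) 0 with hb | hb
    · exact (hneg b (right_mem_Icc.2 hab) hb).trans hle
    rcases le_or_gt 0 (g a) with ha | ha
    · exact (hpos a (left_mem_Icc.2 hab) ha).trans hle
    -- A zero of g separates the two sign regimes; using both pieces doubles the constant.
    obtain ⟨t, ht, hgt⟩ := intermediate_value_Icc hab hgc ⟨ha.le, hb.le⟩
    have hsum := eVariationOn.Icc_add_Icc (fun s => Real.exp (-Q 0 s)) (s := univ) ht.1 ht.2
      (mem_univ t)
    simp only [univ_inter] at hsum
    rw [← hsum]
    refine (add_le_add (hneg t ht hgt.le) (hpos t ht hgt.ge)).trans (le_of_eq ?_)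
    rw [← ENNReal.ofReal_add (by positivity) (by positivity)]
    congr 1
    ring

/-- Cutting [-1, 1] into N equal intervals of length δ = 2/N reduces this to the single-interval
estimate. -/
theorem eVariationOn_exp_neg_le {Q : ℕ → ℝ → ℝ}
    (hQ : ∀ j, ∀ s ∈ Icc (-1 : ℝ) 1, HasDerivWithinAt (Q j) (Q (j + 1) s) (Icc (-1) 1) s)
    {K : ℝ} (hK : 0 ≤ K) (hKQ : ∀ s ∈ Icc (-1 : ℝ) 1, K ≤ Q 0 s) {M N : ℕ} (hN : 1 ≤ N)
    (hM : ∀ s ∈ Icc (-1 : ℝ) 1, (2 / N : ℝ) ^ M * |Q (M + 1) s| ≤ K) :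
    eVariationOn (fun s => Real.exp (-Q 0 s)) (Icc (-1) 1) ≤ ENNReal.ofReal (N * (2 ^ M * 5)) := by
  have hN0 : (0 : ℝ) < N := by exact_mod_cast hN
  set I : ℕ → ℝ := fun i => -1 + i * (2 / N) with hI
  have hmono : Monotone I := fun i j hij => by
    simp only [hI]
    gcongr
  have h0 : I 0 = -1 := by simp [hI]
  have h1 : I N = 1 := by simp only [hI]; field_simp; norm_num
  have hsum := eVariationOn.sum' (fun s => Real.exp (-Q 0 s)) hmono (n := N)
  rw [h0, h1] at hsum
  rw [← hsum]
  have hle : ∀ i ∈ Finset.range N, eVariationOn (fun s => Real.exp (-Q 0 s))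
      (Icc (I i) (I (i + 1))) ≤ ENNReal.ofReal (2 ^ M * 5) := by
    intro i hi
    have hsub : Icc (I i) (I (i + 1)) ⊆ Icc (-1) 1 :=
      Icc_subset_Icc (h0 ▸ hmono (Nat.zero_le i)) (h1 ▸ hmono (Finset.mem_range.1 hi))
    refine eVariationOn_exp_neg_le_of_deriv_ge hQ hK (δ := 2 / N) (by positivity) ?_ hKQ M _ _ 1
      (hmono (Nat.le_succ i)) (by simp only [hI]; push_cast; linarith) hsub (by simp) fun s hs => ?_
    · exact div_le_self (by norm_num) (by exact_mod_cast hN)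
    · have := hM s (hsub hs)
      have h2 := neg_abs_le (Q (M + 1) s)
      have h3 : (0 : ℝ) ≤ (2 / N) ^ M := by positivity
      nlinarith
  refine (Finset.sum_le_card_nsmul _ _ _ hle).trans (le_of_eq ?_)
  rw [Finset.card_range, nsmul_eq_mul, ENNReal.ofReal_mul (p := (N : ℝ)) (by positivity),
    ENNReal.ofReal_natCast]

end Variation

/-! ### Boxes as linear images of the cube; uniform nondegeneracy. -/

section FrameGeometry

variable {n : ℕ}

/-- The linear map whose image of the unit cube is the box with parameters `r` at `s`. -/
noncomputable def boxMap (e : Fin n → ℝ → EuclideanSpace ℝ (Fin n)) (r : Fin n → ℝ) (s : ℝ) :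
    EuclideanSpace ℝ (Fin n) →L[ℝ] EuclideanSpace ℝ (Fin n) :=
  ∑ j, (EuclideanSpace.proj j : EuclideanSpace ℝ (Fin n) →L[ℝ] ℝ).smulRight ((r j)⁻¹ • e j s)

variable {e : Fin n → ℝ → EuclideanSpace ℝ (Fin n)} {r : Fin n → ℝ} {s : ℝ}

theorem boxMap_apply (v : EuclideanSpace ℝ (Fin n)) :
    boxMap e r s v = ∑ j, v j • (r j)⁻¹ • e j s := by
  simp [boxMap]

theorem boxMap_single (j : Fin n) :
    boxMap e r s (EuclideanSpace.single j 1) = (r j)⁻¹ • e j s := by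
  rw [boxMap_apply, Finset.sum_eq_single j]
  · simp
  · intro i _ hij
    simp [hij]
  · simp

theorem det_boxMap : LinearMap.det (boxMap e r s : EuclideanSpace ℝ (Fin n) →ₗ[ℝ] _) =
    (∏ j, (r j)⁻¹) * (Matrix.of fun i j : Fin n => e j s i).det := by
  rw [← LinearMap.det_toMatrix (EuclideanSpace.basisFun (Fin n) ℝ).toBasis, ← Matrix.det_mul_row]
  congr 1
  ext i j
  rw [LinearMap.toMatrix_apply]
  simp [boxMap_single]

theorem adjoint_boxMap_apply (ξ : EuclideanSpace ℝ (Fin n)) (j : Fin n) :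
    ContinuousLinearMap.adjoint (boxMap e r s) ξ j = (r j)⁻¹ * inner ℝ (e j s) ξ := by
  have h := ContinuousLinearMap.adjoint_inner_right (boxMap e r s) (EuclideanSpace.single j 1) ξ
  rw [boxMap_single, real_inner_smul_left] at h
  rw [← h]
  simp [EuclideanSpace.inner_single_left]

theorem norm_sq_adjoint_boxMap (ξ : EuclideanSpace ℝ (Fin n)) :
    ‖ContinuousLinearMap.adjoint (boxMap e r s) ξ‖ ^ 2 =
      ∑ j, ((r j)⁻¹) ^ 2 * (inner ℝ (e j s) ξ) ^ 2 := by
  rw [EuclideanSpace.norm_sq_eq]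
  refine Finset.sum_congr rfl fun j _ => ?_
  rw [adjoint_boxMap_apply, Real.norm_eq_abs, sq_abs, mul_pow]

theorem nikodymBox_eq_image (hr : ∀ j, 0 < r j) :
    nikodymBox e r s = boxMap e r s '' {v | ∀ j, |v j| ≤ 1} := by
  ext x
  constructor
  · rintro ⟨l, hl, rfl⟩
    refine ⟨WithLp.toLp 2 fun j => r j * l j, fun j => ?_, ?_⟩
    · have h := abs_le.2 (hl j)
      simp only [abs_mul, abs_of_pos (hr j)]
      rwa [← le_inv_mul_iff₀ (hr j), mul_one]
    · rw [boxMap_apply]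
      refine Finset.sum_congr rfl fun j _ => ?_
      rw [smul_smul]
      congr 1
      field_simp [(hr j).ne']
  · rintro ⟨v, hv, rfl⟩
    refine ⟨fun j => v j * (r j)⁻¹, fun j => ?_, ?_⟩
    · refine abs_le.1 ?_
      rw [abs_mul, abs_of_pos (inv_pos.2 (hr j))]
      exact mul_le_of_le_one_left (inv_pos.2 (hr j)).le (hv j)
    · rw [boxMap_apply]
      simp only [smul_smul]

theorem det_boxMap_ne_zero (he : IsNondegenerateFrame e) (hr : ∀ j, 0 < r j)
    (hs : s ∈ Icc (-1 : ℝ) 1) : (boxMap e r s).det ≠ 0 := by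
  obtain ⟨c, hc, h⟩ := he.nondegenerate
  have h1 : (boxMap e r s).det = _ := det_boxMap
  rw [h1]
  exact mul_ne_zero (Finset.prod_ne_zero_iff.2 fun j _ => (inv_pos.2 (hr j)).ne')
    (abs_pos.1 (hc.trans_le (h s hs)))

theorem exists_boxEquiv (he : IsNondegenerateFrame e) (hr : ∀ j, 0 < r j)
    (hs : s ∈ Icc (-1 : ℝ) 1) :
    ∃ B : EuclideanSpace ℝ (Fin n) ≃L[ℝ] EuclideanSpace ℝ (Fin n),
      (B : EuclideanSpace ℝ (Fin n) →L[ℝ] EuclideanSpace ℝ (Fin n)) = boxMap e r s :=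
  ⟨(boxMap e r s).toContinuousLinearEquivOfDetNeZero (det_boxMap_ne_zero he hr hs), by ext; simp⟩

/-- The norm of T(s)v attains a positive minimum on the compact set S × (unit sphere); homogeneity
does the rest. -/
theorem exists_norm_lower_bound {V : Type*} [NormedAddCommGroup V] [NormedSpace ℝ V]
    [FiniteDimensional ℝ V] {T : ℝ → V →L[ℝ] V} {S : Set ℝ} (hS : IsCompact S)
    (hT : ContinuousOn T S) (hinj : ∀ s ∈ S, ∀ v, T s v = 0 → v = 0) :
    ∃ c : ℝ, 0 < c ∧ ∀ s ∈ S, ∀ v, c * ‖v‖ ≤ ‖T s v‖ := by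
  have hcomp : IsCompact (S ×ˢ Metric.sphere (0 : V) 1) := hS.prod (isCompact_sphere 0 1)
  have hcont : ContinuousOn (fun p : ℝ × V => ‖T p.1 p.2‖) (S ×ˢ Metric.sphere (0 : V) 1) :=
    ((hT.comp continuousOn_fst fun p hp => hp.1).clm_apply continuousOn_snd).norm
  have key : ∃ c : ℝ, 0 < c ∧ ∀ p ∈ S ×ˢ Metric.sphere (0 : V) 1, c ≤ ‖T p.1 p.2‖ := by
    rcases (S ×ˢ Metric.sphere (0 : V) 1).eq_empty_or_nonempty with h | h
    · exact ⟨1, one_pos, by simp [h]⟩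
    · obtain ⟨p, hp, hmin⟩ := hcomp.exists_isMinOn h hcont
      refine ⟨‖T p.1 p.2‖, norm_pos_iff.2 fun h0 => ?_, fun q hq => hmin hq⟩
      have h1 := hinj p.1 hp.1 p.2 h0
      have h2 := hp.2
      simp [h1] at h2
  obtain ⟨c, hc, hle⟩ := key
  refine ⟨c, hc, fun s hs v => ?_⟩
  rcases eq_or_ne v 0 with rfl | hv
  · simp
  have hv' := norm_pos_iff.2 hv
  have h1 := hle (s, ‖v‖⁻¹ • v) ⟨hs, by simp [norm_smul, hv'.ne']⟩
  simp only [map_smul, norm_smul, norm_inv, norm_norm] at h1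
  rwa [← le_inv_mul_iff₀' hv']

theorem continuousOn_boxMap (he : IsNondegenerateFrame e) (r : Fin n → ℝ) :
    ContinuousOn (boxMap e r) (Icc (-1) 1) := by
  unfold boxMap
  refine continuousOn_finsetSum _ fun j _ => ?_
  have h : ContinuousOn (fun s => (r j)⁻¹ • e j s) (Icc (-1) 1) :=
    (he.smooth j).continuousOn.fun_const_smul _
  exact ((ContinuousLinearMap.smulRightL ℝ (EuclideanSpace ℝ (Fin n)) (EuclideanSpace ℝ (Fin n))
    (EuclideanSpace.proj j)).continuous.comp_continuousOn h)

theorem exists_lower_bound_boxMap (he : IsNondegenerateFrame e) :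
    ∃ c : ℝ, 0 < c ∧ ∀ s ∈ Icc (-1 : ℝ) 1, ∀ v, c * ‖v‖ ≤ ‖boxMap e 1 s v‖ := by
  refine exists_norm_lower_bound isCompact_Icc (continuousOn_boxMap he 1) fun s hs v hv => ?_
  obtain ⟨B, hB⟩ := exists_boxEquiv (r := 1) he (fun _ => one_pos) hs
  rw [← hB] at hv
  simpa using hv

theorem exists_lower_bound_adjoint_boxMap (he : IsNondegenerateFrame e) :
    ∃ c : ℝ, 0 < c ∧ ∀ s ∈ Icc (-1 : ℝ) 1, ∀ v,
      c * ‖v‖ ≤ ‖ContinuousLinearMap.adjoint (boxMap e 1 s) v‖ := by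
  refine exists_norm_lower_bound isCompact_Icc
    (T := fun s => ContinuousLinearMap.adjoint (boxMap e 1 s))
    (ContinuousLinearMap.adjoint.continuous.comp_continuousOn (continuousOn_boxMap he 1))
    fun s hs v hv => ?_
  obtain ⟨B, hB⟩ := exists_boxEquiv (r := 1) he (fun _ => one_pos) hs
  have h := ContinuousLinearMap.adjoint_inner_right (boxMap e 1 s) (B.symm v) v
  rw [hv, inner_zero_right, ← hB] at h
  simpa using h.symm

end FrameGeometry

/-! ### Variation of the Gaussian multipliers. -/

section MultiplierVariation

theorem hasDerivWithinAt_iteratedDerivWithin {f : ℝ → ℝ} {S : Set ℝ} (hS : UniqueDiffOn ℝ S)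
    (hf : ContDiffOn ℝ ∞ f S) (j : ℕ) {s : ℝ} (hs : s ∈ S) :
    HasDerivWithinAt (iteratedDerivWithin j f S) (iteratedDerivWithin (j + 1) f S s) S s := by
  rw [iteratedDerivWithin_succ]
  exact ((hf.differentiableOn_iteratedDerivWithin (by exact_mod_cast WithTop.coe_lt_top j) hS)
    s hs).hasDerivWithinAt

/-- The derivative is linear in the coefficients, so C depends only on the fixed functions u. This
makes the derivative bounds for the phase uniform in r and ξ. -/
theorem exists_bound_iteratedDerivWithin_sum {ι : Type*} [Fintype ι] {u : ι → ℝ → ℝ} {S : Set ℝ}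
    (hS : UniqueDiffOn ℝ S) (hc : IsCompact S) (hu : ∀ i, ContDiffOn ℝ ∞ (u i) S) (M : ℕ) :
    ∃ C : ℝ, 0 ≤ C ∧ ∀ (a : ι → ℝ) (X : ℝ), (∀ i, |a i| ≤ X) → ∀ s ∈ S,
      |iteratedDerivWithin M (fun s => ∑ i, a i * u i s) S s| ≤ C * X := by
  have h1 : ∀ i, ∃ C : ℝ, ∀ s ∈ S, ‖iteratedDerivWithin M (u i) S s‖ ≤ C := fun i =>
    hc.exists_bound_of_continuousOn
      ((hu i).continuousOn_iteratedDerivWithin (by exact_mod_cast le_top) hS)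
  choose C hC using h1
  refine ⟨∑ i, |C i|, Finset.sum_nonneg fun _ _ => abs_nonneg _, fun a X hX s hs => ?_⟩
  have h2 : ∀ i, ContDiffWithinAt ℝ M (u i) S s := fun i =>
    (hu i s hs).of_le (by exact_mod_cast le_top)
  rw [iteratedDerivWithin_fun_sum hs hS fun i _ => contDiffWithinAt_const.mul (h2 i), Finset.sum_mul]
  refine (Finset.abs_sum_le_sum_abs _ _).trans (Finset.sum_le_sum fun i _ => ?_)
  rw [iteratedDerivWithin_const_mul hs hS _ (h2 i), abs_mul, mul_comm]
  exact mul_le_mul ((hC i s hs).trans (le_abs_self _)) (hX i) (abs_nonneg _) (abs_nonneg _)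

variable {n : ℕ} {e : Fin n → ℝ → EuclideanSpace ℝ (Fin n)}

theorem pi_mul_norm_sq_adjoint_boxMap_eq_sum (r : Fin n → ℝ) (ξ : EuclideanSpace ℝ (Fin n))
    (s : ℝ) :
    Real.pi * ‖ContinuousLinearMap.adjoint (boxMap e r s) ξ‖ ^ 2 =
      ∑ p : Fin n × Fin n × Fin n, (Real.pi * ((r p.1)⁻¹ ^ 2 * (ξ p.2.1 * ξ p.2.2))) *
        (e p.1 s p.2.1 * e p.1 s p.2.2) := by
  rw [norm_sq_adjoint_boxMap, Finset.mul_sum, Fintype.sum_prod_type]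
  refine Finset.sum_congr rfl fun k _ => ?_
  rw [Fintype.sum_prod_type, PiLp.inner_apply, pow_two (∑ _, _), Finset.sum_mul_sum,
    Finset.mul_sum, Finset.mul_sum]
  refine Finset.sum_congr rfl fun a _ => ?_
  rw [Finset.mul_sum, Finset.mul_sum]
  refine Finset.sum_congr rfl fun b _ => ?_
  simp only [RCLike.inner_apply, conj_trivial]
  ring

theorem contDiffOn_coord (he : IsNondegenerateFrame e) (k a : Fin n) :
    ContDiffOn ℝ ∞ (fun s => e k s a) (Icc (-1) 1) :=
  (EuclideanSpace.proj a : EuclideanSpace ℝ (Fin n) →L[ℝ] ℝ).contDiff.comp_contDiffOn (he.smooth k)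

/-- The Gaussian multipliers have total variation `O(ecc ^ ε)` in the parameter. -/
theorem exists_eVariationOn_multiplier_le (he : IsNondegenerateFrame e) {ε : ℝ} (hε : 0 < ε) :
    ∃ A : ℝ, 1 ≤ A ∧ ∀ (r : Fin n → ℝ) (ρ R : ℝ), 0 < ρ → ρ ≤ R → (∀ j, ρ ≤ r j) → (∀ j, r j ≤ R) →
      ∀ ξ, eVariationOn (fun s => Real.exp (-(Real.pi *
        ‖ContinuousLinearMap.adjoint (boxMap e r s) ξ‖ ^ 2))) (Icc (-1) 1) ≤
          ENNReal.ofReal (A * (R / ρ) ^ ε) := by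
  obtain ⟨c, hc, hlow⟩ := exists_lower_bound_adjoint_boxMap he
  have hS : UniqueDiffOn ℝ (Icc (-1 : ℝ) 1) := uniqueDiffOn_Icc (by norm_num)
  -- M is large enough that (x^ε)^M ≥ x² for x ≥ 1; x² is the ratio of the derivative bound (with
  -- 1/ρ²) to the lower bound (with 1/R²).
  set M : ℕ := ⌈2 / ε⌉₊ with hM
  have hM1 : 1 ≤ M := Nat.one_le_ceil_iff.2 (by positivity)
  have hMε : 2 ≤ ε * M := by
    have := Nat.le_ceil (2 / ε)
    rw [div_le_iff₀ hε] at this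
    linarith
  have hu : ∀ p : Fin n × Fin n × Fin n,
      ContDiffOn ℝ ∞ (fun s => e p.1 s p.2.1 * e p.1 s p.2.2) (Icc (-1) 1) := fun p =>
    (contDiffOn_coord he _ _).mul (contDiffOn_coord he _ _)
  obtain ⟨C, hC, hder⟩ := exists_bound_iteratedDerivWithin_sum hS isCompact_Icc hu (M + 1)
  set D : ℝ := max 1 (C / c ^ 2) with hD
  have hD1 : 1 ≤ D := le_max_left _ _
  have hDC : C ≤ c ^ 2 * D := by
    rw [← div_le_iff₀' (by positivity)]
    exact le_max_right _ _
  refine ⟨3 * D * (2 ^ M * 5), ?_, fun r ρ R hρ hρR hrρ hrR ξ => ?_⟩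
  · have : (1 : ℝ) ≤ 2 ^ M := one_le_pow₀ (by norm_num)
    nlinarith
  have hR : 0 < R := hρ.trans_le hρR
  have hr : ∀ j, 0 < r j := fun j => hρ.trans_le (hrρ j)
  set x : ℝ := R / ρ with hx
  have hx1 : 1 ≤ x := (one_le_div hρ).2 hρR
  have hxε : 1 ≤ x ^ ε := Real.one_le_rpow hx1 hε.le
  -- The interval length is then 2/N ≤ 1/(D x^ε). Its M-th power absorbs both x² and the ratio C/c²
  -- hidden in D.
  set N : ℕ := ⌈2 * D * x ^ ε⌉₊ with hN
  have hNle : 2 * D * x ^ ε ≤ N := Nat.le_ceil _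
  have hDx : 1 ≤ D * x ^ ε := one_le_mul_of_one_le_of_one_le hD1 hxε
  have hNlt : (N : ℝ) ≤ 3 * D * x ^ ε := by
    have := (Nat.ceil_lt_add_one (by positivity : 0 ≤ 2 * D * x ^ ε)).le
    linarith
  have hNpos : (0 : ℝ) < N := by linarith
  have hN1 : 1 ≤ N := by exact_mod_cast hNpos
  set q : ℝ → ℝ := fun s => Real.pi * ‖ContinuousLinearMap.adjoint (boxMap e r s) ξ‖ ^ 2 with hq
  have hqsum : q = fun s => ∑ p : Fin n × Fin n × Fin n,
      (Real.pi * ((r p.1)⁻¹ ^ 2 * (ξ p.2.1 * ξ p.2.2))) * (e p.1 s p.2.1 * e p.1 s p.2.2) :=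
    funext fun s => pi_mul_norm_sq_adjoint_boxMap_eq_sum r ξ s
  have hqs : ContDiffOn ℝ ∞ q (Icc (-1) 1) := by
    rw [hqsum]
    exact ContDiffOn.sum fun p _ => contDiffOn_const.mul (hu p)
  set K : ℝ := Real.pi * (R⁻¹ ^ 2 * (c * ‖ξ‖) ^ 2) with hK
  have hKq : ∀ s ∈ Icc (-1 : ℝ) 1, K ≤ q s := by
    intro s hs
    refine mul_le_mul_of_nonneg_left ?_ Real.pi_pos.le
    calc R⁻¹ ^ 2 * (c * ‖ξ‖) ^ 2
        ≤ R⁻¹ ^ 2 * ‖ContinuousLinearMap.adjoint (boxMap e 1 s) ξ‖ ^ 2 := by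
          gcongr
          exact hlow s hs ξ
      _ ≤ _ := by
          rw [norm_sq_adjoint_boxMap, norm_sq_adjoint_boxMap, Finset.mul_sum]
          refine Finset.sum_le_sum fun j _ => ?_
          simp only [Pi.one_apply, inv_one, one_pow, one_mul]
          gcongr
          · exact hr j
          · exact hrR j
  set X : ℝ := Real.pi * (ρ⁻¹ ^ 2 * ‖ξ‖ ^ 2) with hX
  have hcoef : ∀ p : Fin n × Fin n × Fin n,
      |Real.pi * ((r p.1)⁻¹ ^ 2 * (ξ p.2.1 * ξ p.2.2))| ≤ X := by
    intro p
    rw [abs_mul, abs_of_pos Real.pi_pos, abs_mul, abs_mul, abs_of_nonneg (by positivity), hX,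
      pow_two ‖ξ‖]
    have h1 : ∀ a, |ξ a| ≤ ‖ξ‖ := fun a => PiLp.norm_apply_le ξ a
    have h2 := hrρ p.1
    refine mul_le_mul_of_nonneg_left ?_ Real.pi_pos.le
    gcongr
    · exact (inv_pos.2 (hr _)).le
    · exact h1 _
    · exact h1 _
  have hfin := eVariationOn_exp_neg_le (Q := fun j => iteratedDerivWithin j q (Icc (-1) 1))
    (fun j s hs => hasDerivWithinAt_iteratedDerivWithin hS hqs j hs) (K := K) (by positivity)
    (by simpa using hKq) (M := M) hN1 ?_
  · simp only [iteratedDerivWithin_zero] at hfin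
    refine hfin.trans (ENNReal.ofReal_le_ofReal ?_)
    calc (N : ℝ) * (2 ^ M * 5) ≤ (3 * D * x ^ ε) * (2 ^ M * 5) := by gcongr
      _ = _ := by ring
  · intro s hs
    have h1 : |iteratedDerivWithin (M + 1) q (Icc (-1) 1) s| ≤ C * X := by
      rw [hqsum]
      exact hder _ X hcoef s hs
    have h2 : (2 / N : ℝ) ≤ (D * x ^ ε)⁻¹ := by
      rw [div_le_iff₀ hNpos, ← div_le_iff₀' (by positivity), div_inv_eq_mul]
      linarith
    have h3 : D * x ^ 2 ≤ (D * x ^ ε) ^ M := by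
      rw [mul_pow]
      have h4 : x ^ (2 : ℕ) ≤ (x ^ ε) ^ M := by
        rw [← Real.rpow_natCast, ← Real.rpow_natCast, ← Real.rpow_mul (by linarith)]
        exact Real.rpow_le_rpow_of_exponent_le hx1 (by exact_mod_cast hMε)
      exact mul_le_mul (le_self_pow₀ hD1 (by omega)) h4 (by positivity) (by positivity)
    calc (2 / N : ℝ) ^ M * |iteratedDerivWithin (M + 1) q (Icc (-1) 1) s|
        ≤ ((D * x ^ ε)⁻¹) ^ M * (C * X) := by gcongr
      _ ≤ (D * x ^ 2)⁻¹ * ((c ^ 2 * D) * X) := by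
          rw [inv_pow]
          gcongr
      _ = K := by
          rw [hK, hX, hx]
          field_simp

end MultiplierVariation

/-! ### Domination of box averages by nearby Gaussians. -/

section Domination

variable {n : ℕ} {e : Fin n → ℝ → EuclideanSpace ℝ (Fin n)} {r : Fin n → ℝ} {s : ℝ}

theorem isCompact_cube : IsCompact {v : EuclideanSpace ℝ (Fin n) | ∀ j, |v j| ≤ 1} := by
  refine Metric.isCompact_of_isClosed_isBounded ?_ ?_
  · simp only [ofPred_forall]
    exact isClosed_iInter fun j => isClosed_le (by fun_prop) continuous_const
  · refine (Metric.isBounded_closedBall (x := (0 : EuclideanSpace ℝ (Fin n)))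
      (r := √n)).subset fun v hv => ?_
    rw [mem_closedBall_zero_iff, EuclideanSpace.norm_eq]
    refine Real.sqrt_le_sqrt ?_
    have h : ∀ j ∈ Finset.univ, ‖v j‖ ^ 2 ≤ (1 : ℝ) := fun j _ =>
      pow_le_one₀ (norm_nonneg _) (hv j)
    simpa using Finset.sum_le_card_nsmul _ _ _ h

theorem volume_cube_pos : 0 < volume {v : EuclideanSpace ℝ (Fin n) | ∀ j, |v j| ≤ 1} := by
  refine (Metric.measure_ball_pos volume (0 : EuclideanSpace ℝ (Fin n)) one_pos).trans_le
    (measure_mono fun v hv j => ?_)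
  rw [mem_ball_zero_iff] at hv
  exact (PiLp.norm_apply_le v j).trans hv.le

theorem convex_cube : Convex ℝ {v : EuclideanSpace ℝ (Fin n) | ∀ j, |v j| ≤ 1} := by
  intro v hv w hw a b ha hb hab j
  simp only [PiLp.add_apply, PiLp.smul_apply, smul_eq_mul]
  have h1 := abs_le.1 (hv j)
  have h2 := abs_le.1 (hw j)
  rw [abs_le]
  constructor <;> nlinarith

theorem isCompact_nikodymBox (hr : ∀ j, 0 < r j) : IsCompact (nikodymBox e r s) := by
  rw [nikodymBox_eq_image hr]
  exact isCompact_cube.image (boxMap e r s).continuous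

theorem convex_nikodymBox (hr : ∀ j, 0 < r j) : Convex ℝ (nikodymBox e r s) := by
  rw [nikodymBox_eq_image hr]
  exact convex_cube.linear_image (boxMap e r s).toLinearMap

theorem volume_nikodymBox (hr : ∀ j, 0 < r j) :
    volume (nikodymBox e r s) =
      ENNReal.ofReal |LinearMap.det (boxMap e r s : EuclideanSpace ℝ (Fin n) →ₗ[ℝ] _)| *
        volume {v : EuclideanSpace ℝ (Fin n) | ∀ j, |v j| ≤ 1} := by
  rw [nikodymBox_eq_image hr]
  exact Measure.addHaar_image_continuousLinearMap volume _ _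

theorem exists_lipschitz_bound (he : IsNondegenerateFrame e) :
    ∃ K : ℝ, 0 ≤ K ∧ ∀ j, ∀ s ∈ Icc (-1 : ℝ) 1, ∀ t ∈ Icc (-1 : ℝ) 1,
      ‖e j s - e j t‖ ≤ K * |s - t| := by
  have h := fun j => (he.smooth j).exists_lipschitzOnWith (by simp) (convex_Icc _ _) isCompact_Icc
  choose K hK using h
  refine ⟨∑ j, (K j : ℝ), Finset.sum_nonneg fun _ _ => NNReal.coe_nonneg _,
    fun j s hs t ht => ?_⟩
  have h1 := (hK j).norm_sub_le hs ht
  refine h1.trans ?_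
  rw [Real.norm_eq_abs]
  gcongr
  exact Finset.single_le_sum (f := fun j => (K j : ℝ)) (fun _ _ => NNReal.coe_nonneg _)
    (Finset.mem_univ j)

/-- Moving the frame from s to t displaces a point with fixed box coordinates by O(|s - t|/ρ).
Measured in box coordinates this is O(|s - t| R/ρ), made at most 1 by the choice of η. -/
theorem exists_coord_le_two (he : IsNondegenerateFrame e) :
    ∃ η : ℝ, 0 < η ∧ η ≤ 1 ∧ ∀ (r : Fin n → ℝ) (ρ R : ℝ), 0 < ρ → ρ ≤ R → (∀ j, ρ ≤ r j) →
      (∀ j, r j ≤ R) → ∀ s ∈ Icc (-1 : ℝ) 1, ∀ t ∈ Icc (-1 : ℝ) 1, |s - t| ≤ η / (R / ρ) →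
        ∀ v w, (∀ j, |v j| ≤ 1) → boxMap e r t w = boxMap e r s v → ∀ j, |w j| ≤ 2 := by
  obtain ⟨c, hc, hlow⟩ := exists_lower_bound_boxMap he
  obtain ⟨K, hK, hlip⟩ := exists_lipschitz_bound he
  -- The + 1 keeps the denominator positive when the Lipschitz bound K is zero.
  refine ⟨min 1 (c / (n * K + 1)), by positivity, min_le_left _ _, ?_⟩
  intro r ρ R hρ hρR hrρ hrR s hs t ht hst v w hv hw j
  have hR : 0 < R := hρ.trans_le hρR
  have hr : ∀ j, 0 < r j := fun j => hρ.trans_le (hrρ j)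
  -- Rescaling the coordinate difference reduces to r = 1, where the lower bound for the frame map
  -- is uniform.
  set z : EuclideanSpace ℝ (Fin n) := WithLp.toLp 2 fun j => (w j - v j) * (r j)⁻¹ with hz
  have h1 : boxMap e 1 t z = ∑ j, (v j * (r j)⁻¹) • (e j s - e j t) := by
    have h2 : boxMap e 1 t z = boxMap e r t w - boxMap e r t v := by
      rw [← map_sub, boxMap_apply, boxMap_apply]
      refine Finset.sum_congr rfl fun j _ => ?_
      simp [hz, smul_smul]
    rw [h2, hw, boxMap_apply, boxMap_apply, ← Finset.sum_sub_distrib]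
    refine Finset.sum_congr rfl fun j _ => ?_
    rw [smul_sub, smul_smul, smul_smul]
  have h3 : ‖boxMap e 1 t z‖ ≤ n * (ρ⁻¹ * (K * |s - t|)) := by
    rw [h1]
    have h4 : ∀ j ∈ Finset.univ, ‖(v j * (r j)⁻¹) • (e j s - e j t)‖ ≤ ρ⁻¹ * (K * |s - t|) := by
      intro j _
      rw [norm_smul, Real.norm_eq_abs, abs_mul, abs_of_pos (inv_pos.2 (hr j))]
      have h5 : |v j| * (r j)⁻¹ ≤ 1 * ρ⁻¹ := by
        gcongr
        · exact (inv_pos.2 (hr j)).le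
        · exact hv j
        · exact hrρ j
      rw [one_mul] at h5
      exact mul_le_mul h5 (hlip j s hs t ht) (norm_nonneg _) (inv_pos.2 hρ).le
    refine (norm_sum_le_of_le _ h4).trans (le_of_eq ?_)
    simp
  have h6 : c * |z j| ≤ n * (ρ⁻¹ * (K * |s - t|)) :=
    (mul_le_mul_of_nonneg_left (PiLp.norm_apply_le z j) hc.le).trans ((hlow t ht z).trans h3)
  have h7 : |s - t| * (R / ρ) ≤ c / (n * K + 1) := by
    rw [← le_div_iff₀ (by positivity)]
    exact hst.trans (by gcongr; exact min_le_right _ _)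
  have h8 : |w j - v j| ≤ 1 := by
    have h9 : |z j| = |w j - v j| * (r j)⁻¹ := by
      simp only [hz, abs_mul, abs_of_pos (inv_pos.2 (hr j))]
    have h10 : |w j - v j| = |z j| * r j := by
      rw [h9, inv_mul_cancel_right₀ (hr j).ne']
    rw [h10]
    have h11 : c * (|z j| * R) ≤ c * 1 := by
      calc c * (|z j| * R) = (c * |z j|) * R := by ring
        _ ≤ (n * (ρ⁻¹ * (K * |s - t|))) * R := by gcongr
        _ = n * K * (|s - t| * (R / ρ)) := by field_simp
        _ ≤ n * K * (c / (n * K + 1)) := by gcongr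
        _ ≤ c * 1 := by
          rw [mul_div_assoc', div_le_iff₀ (by positivity)]
          nlinarith
    exact (mul_le_mul_of_nonneg_left (hrR j) (abs_nonneg _)).trans (le_of_mul_le_mul_left h11 hc)
  have h12 := hv j
  have h13 := abs_add_le (w j - v j) (v j)
  rw [sub_add_cancel] at h13
  linarith

/-- The factor ∏ 1/r_j is common to both determinants, leaving frame determinants bounded above by
compactness and below by nondegeneracy. -/
theorem exists_det_comparison (he : IsNondegenerateFrame e) :
    ∃ U : ℝ, 0 < U ∧ ∀ r : Fin n → ℝ, ∀ s ∈ Icc (-1 : ℝ) 1, ∀ t ∈ Icc (-1 : ℝ) 1,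
      |LinearMap.det (boxMap e r t : EuclideanSpace ℝ (Fin n) →ₗ[ℝ] _)| ≤
        U * |LinearMap.det (boxMap e r s : EuclideanSpace ℝ (Fin n) →ₗ[ℝ] _)| := by
  obtain ⟨c, hc, hlow⟩ := he.nondegenerate
  have hcont : ContinuousOn (fun s => (Matrix.of fun i j : Fin n => e j s i).det) (Icc (-1) 1) := by
    refine (continuous_id.matrix_det).comp_continuousOn
      (continuousOn_pi.2 fun i => continuousOn_pi.2 fun j => ?_)
    exact (contDiffOn_coord he j i).continuousOn
  obtain ⟨U, hU⟩ := isCompact_Icc.exists_bound_of_continuousOn hcont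
  refine ⟨max 1 (U / c), by positivity, fun r s hs t ht => ?_⟩
  rw [det_boxMap, det_boxMap, abs_mul, abs_mul, mul_left_comm]
  gcongr
  calc _ ≤ U := hU t ht
    _ = U / c * c := by field_simp
    _ ≤ _ := by
      gcongr
      · exact le_max_right _ _
      · exact hlow s hs

/-- Up to a constant, the normalised indicator function of a box is dominated by the Gaussian
adapted to any box with a sufficiently close parameter. -/
theorem exists_inv_volume_le_gaussianKernel (he : IsNondegenerateFrame e) :
    ∃ η C : ℝ, 0 < η ∧ η ≤ 1 ∧ 0 < C ∧ ∀ (r : Fin n → ℝ) (ρ R : ℝ), 0 < ρ → ρ ≤ R →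
      (∀ j, ρ ≤ r j) → (∀ j, r j ≤ R) → ∀ s ∈ Icc (-1 : ℝ) 1, ∀ t ∈ Icc (-1 : ℝ) 1,
        |s - t| ≤ η / (R / ρ) → ∀ B : EuclideanSpace ℝ (Fin n) ≃L[ℝ] EuclideanSpace ℝ (Fin n),
          (B : EuclideanSpace ℝ (Fin n) →L[ℝ] EuclideanSpace ℝ (Fin n)) = boxMap e r t →
            ∀ y ∈ nikodymBox e r s,
              (volume.real (nikodymBox e r s))⁻¹ ≤ C * gaussianKernel B y := by
  obtain ⟨η, hη, hη1, hcoord⟩ := exists_coord_le_two he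
  obtain ⟨U, hU, hdet⟩ := exists_det_comparison he
  set v₀ : ℝ := volume.real {v : EuclideanSpace ℝ (Fin n) | ∀ j, |v j| ≤ 1} with hv₀
  have hv₀pos : 0 < v₀ := ENNReal.toReal_pos volume_cube_pos.ne' isCompact_cube.measure_ne_top
  -- The exponential compensates the Gaussian's decay at points with coordinates at most 2, whose
  -- squared norm is at most 4n; U compares the two volumes and v₀ is the volume of the cube.
  refine ⟨η, v₀⁻¹ * U * Real.exp (Real.pi * (4 * n)), hη, hη1, by positivity, ?_⟩
  intro r ρ R hρ hρR hrρ hrR s hs t ht hst B hB y hy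
  have hr : ∀ j, 0 < r j := fun j => hρ.trans_le (hrρ j)
  have hvol : volume.real (nikodymBox e r s) =
      |LinearMap.det (boxMap e r s : EuclideanSpace ℝ (Fin n) →ₗ[ℝ] _)| * v₀ := by
    rw [measureReal_def, volume_nikodymBox hr, ENNReal.toReal_mul,
      ENNReal.toReal_ofReal (abs_nonneg _), hv₀, measureReal_def]
  rw [nikodymBox_eq_image hr] at hy
  obtain ⟨v, hv, rfl⟩ := hy
  have hw : boxMap e r t (B.symm (boxMap e r s v)) = boxMap e r s v := by
    rw [← hB]
    simp
  have h2 := hcoord r ρ R hρ hρR hrρ hrR s hs t ht hst v _ hv hw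
  have h3 : ‖B.symm (boxMap e r s v)‖ ^ 2 ≤ 4 * n := by
    rw [EuclideanSpace.norm_sq_eq]
    have h4 : ∀ j ∈ Finset.univ, ‖B.symm (boxMap e r s v) j‖ ^ 2 ≤ (4 : ℝ) := fun j _ => by
      have := h2 j
      rw [Real.norm_eq_abs]
      nlinarith [abs_nonneg (B.symm (boxMap e r s v) j)]
    have h5 := Finset.sum_le_card_nsmul _ _ _ h4
    simp only [Finset.card_univ, Fintype.card_fin, nsmul_eq_mul] at h5
    linarith
  have h6 : 1 ≤ Real.exp (Real.pi * (4 * n)) *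
      Real.exp (-Real.pi * ‖B.symm (boxMap e r s v)‖ ^ 2) := by
    rw [← Real.exp_add, Real.one_le_exp_iff]
    have := Real.pi_pos
    nlinarith
  have hdB : |LinearMap.det (B : EuclideanSpace ℝ (Fin n) →ₗ[ℝ] EuclideanSpace ℝ (Fin n))| ≤
      U * |LinearMap.det (boxMap e r s : EuclideanSpace ℝ (Fin n) →ₗ[ℝ] _)| := by
    have := hdet r s hs t ht
    rwa [← hB] at this
  have hdBpos := abs_det_pos B
  have hds : 0 < |LinearMap.det (boxMap e r s : EuclideanSpace ℝ (Fin n) →ₗ[ℝ] _)| :=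
    abs_pos.2 (det_boxMap_ne_zero he hr hs)
  rw [hvol, gaussianKernel, mul_inv]
  have h7 : |LinearMap.det (boxMap e r s : EuclideanSpace ℝ (Fin n) →ₗ[ℝ] _)|⁻¹ ≤
      U * |LinearMap.det (B : EuclideanSpace ℝ (Fin n) →ₗ[ℝ] EuclideanSpace ℝ (Fin n))|⁻¹ := by
    rw [inv_le_comm₀ hds (by positivity), mul_inv, inv_inv, inv_mul_le_iff₀ hU]
    exact hdB
  calc _ ≤ (U * |LinearMap.det (B : EuclideanSpace ℝ (Fin n) →ₗ[ℝ] _)|⁻¹ * v₀⁻¹) * 1 := by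
        rw [mul_one]
        gcongr
    _ ≤ (U * |LinearMap.det (B : EuclideanSpace ℝ (Fin n) →ₗ[ℝ] _)|⁻¹ * v₀⁻¹) *
        (Real.exp (Real.pi * (4 * n)) *
          Real.exp (-Real.pi * ‖B.symm (boxMap e r s v)‖ ^ 2)) := by gcongr
    _ = _ := by ring

theorem enorm_integral_mul_norm_sub {G : EuclideanSpace ℝ (Fin n) → ℝ} (hG : ∀ y, 0 ≤ G y)
    (hG2 : MemLp (fun y => (G y : ℂ)) 2 volume) {f : EuclideanSpace ℝ (Fin n) → ℂ}
    (hf : MemLp f 2 volume) (x : EuclideanSpace ℝ (Fin n)) :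
    ‖∫ y, (G y : ℂ) * (‖f (x - y)‖ : ℂ)‖ₑ = ∫⁻ y, ENNReal.ofReal (G y) * ‖f (x - y)‖ₑ := by
  have hF : MemLp (fun x => (‖f x‖ : ℂ)) 2 volume := hf.norm.ofReal
  have hi := integrable_mul_sub hG2 hF x
  have hi' : Integrable fun y => G y * ‖f (x - y)‖ := by
    have := hi.re
    simpa [← Complex.ofReal_mul] using this
  simp_rw [← Complex.ofReal_mul]
  have h0 : ∀ y, 0 ≤ G y * ‖f (x - y)‖ := fun y => mul_nonneg (hG y) (norm_nonneg _)
  rw [integral_complex_ofReal, ← ofReal_norm, Complex.norm_real,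
    Real.norm_of_nonneg (integral_nonneg h0),
    ofReal_integral_eq_lintegral_ofReal hi' (.of_forall h0)]
  refine lintegral_congr fun y => ?_
  rw [ENNReal.ofReal_mul (hG y), ofReal_norm]

theorem enorm_nikodymAverage_le {f : EuclideanSpace ℝ (Fin n) → ℂ} (hf : MemLp f 2 volume)
    {G : EuclideanSpace ℝ (Fin n) → ℝ} (hG : ∀ y, 0 ≤ G y)
    (hG2 : MemLp (fun y => (G y : ℂ)) 2 volume) {C : ℝ} (hC : 0 < C) (hr : ∀ j, 0 < r j)
    (h : ∀ y ∈ nikodymBox e r s, (volume.real (nikodymBox e r s))⁻¹ ≤ C * G y)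
    (x : EuclideanSpace ℝ (Fin n)) :
    ‖nikodymAverage e r f x s‖ₑ ≤
      ENNReal.ofReal C * ‖∫ y, (G y : ℂ) * (‖f (x - y)‖ : ℂ)‖ₑ := by
  have hmeas : MeasurableSet (nikodymBox e r s) := (isCompact_nikodymBox hr).isClosed.measurableSet
  rw [enorm_integral_mul_norm_sub hG hG2 hf, nikodymAverage, setAverage_eq, enorm_smul,
    ← lintegral_const_mul' _ _ ENNReal.ofReal_ne_top]
  calc _ ≤ ‖(volume.real (nikodymBox e r s))⁻¹‖ₑ * ∫⁻ y in nikodymBox e r s, ‖f (x - y)‖ₑ := by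
        gcongr
        exact enorm_integral_le_lintegral_enorm _
    _ = ∫⁻ y in nikodymBox e r s, ‖(volume.real (nikodymBox e r s))⁻¹‖ₑ * ‖f (x - y)‖ₑ :=
        (lintegral_const_mul' _ _ enorm_ne_top).symm
    _ ≤ ∫⁻ y in nikodymBox e r s, ENNReal.ofReal C * (ENNReal.ofReal (G y) * ‖f (x - y)‖ₑ) := by
        refine setLIntegral_mono' hmeas fun y hy => ?_
        rw [← mul_assoc, ← ENNReal.ofReal_mul hC.le]
        gcongr
        rw [Real.enorm_of_nonneg (by positivity)]
        exact ENNReal.ofReal_le_ofReal (h y hy)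
    _ ≤ _ := setLIntegral_le_lintegral _ _

end Domination

/-! ### Measurability of the maximal function. -/

section Measurability

variable {n : ℕ} {e : Fin n → ℝ → EuclideanSpace ℝ (Fin n)} {r : Fin n → ℝ} {s : ℝ}

theorem continuousAt_indicator_const {X Y : Type*} [TopologicalSpace X] [TopologicalSpace Y]
    [Zero Y] {T : Set X} {x : X} (hx : x ∉ frontier T) (c : Y) :
    ContinuousAt (T.indicator fun _ => c) x := by
  by_cases h : x ∈ interior T
  · refine (continuousAt_const (y := c)).congr ?_
    filter_upwards [mem_interior_iff_mem_nhds.1 h] with y hy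
    rw [indicator_of_mem hy]
  · have h' : x ∈ interior Tᶜ := by
      rw [interior_compl]
      exact fun hc => hx ⟨hc, h⟩
    refine (continuousAt_const (y := (0 : Y))).congr ?_
    filter_upwards [mem_interior_iff_mem_nhds.1 h'] with y hy
    rw [indicator_of_notMem hy]

/-- A convex set has null boundary, so translating the indicator of T is continuous at almost every
point, and dominated convergence applies. -/
theorem continuous_setIntegral_sub {V : Type*} [NormedAddCommGroup V] [InnerProductSpace ℝ V]
    [FiniteDimensional ℝ V] [MeasurableSpace V] [BorelSpace V] {T : Set V} (hT : IsCompact T)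
    (hconv : Convex ℝ T) {f : V → ℂ} (hf : LocallyIntegrable f volume) :
    Continuous fun x => ∫ y in T, f (x - y) := by
  have hmeas : MeasurableSet T := hT.isClosed.measurableSet
  have hrw : ∀ x, ∫ y in T, f (x - y) = ∫ z, T.indicator (fun _ => f z) (x - z) := by
    intro x
    rw [← integral_indicator hmeas,
      ← integral_sub_left_eq_self (fun z => T.indicator (fun _ => f z) (x - z)) volume x]
    refine integral_congr_ae (.of_forall fun y => ?_)
    by_cases hy : y ∈ T <;> simp [hy]
  simp_rw [hrw]
  obtain ⟨ρ, hρ⟩ := hT.isBounded.subset_closedBall (0 : V)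
  refine continuous_iff_continuousAt.2 fun x₀ => ?_
  refine continuousAt_of_dominated
    (bound := (Metric.closedBall x₀ (ρ + 1)).indicator fun z => ‖f z‖) (.of_forall fun x => ?_)
    ?_ ?_ ?_
  · have h : (fun z => T.indicator (fun _ => f z) (x - z)) =
        ((fun z => x - z) ⁻¹' T).indicator f := by
      ext z
      by_cases hz : x - z ∈ T <;> simp [hz]
    rw [h]
    exact hf.aestronglyMeasurable.indicator (hmeas.preimage (by fun_prop))
  · filter_upwards [Metric.ball_mem_nhds x₀ one_pos] with x hx
    refine .of_forall fun z => ?_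
    by_cases hz : x - z ∈ T
    · rw [indicator_of_mem hz, indicator_of_mem]
      rw [Metric.mem_closedBall, dist_comm]
      have h1 := hρ hz
      rw [mem_closedBall_zero_iff, ← dist_eq_norm] at h1
      have h2 := Metric.mem_ball.1 hx
      rw [dist_comm] at h2
      linarith [dist_triangle x₀ x z]
    · rw [indicator_of_notMem hz, norm_zero]
      exact indicator_nonneg (fun _ _ => norm_nonneg _) _
  · rw [integrable_indicator_iff measurableSet_closedBall]
    exact (hf.integrableOn_isCompact (isCompact_closedBall _ _)).norm
  · have h0 : volume (frontier T) = 0 := hconv.addHaar_frontier volume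
    have h1 := (measurePreserving_sub_left' x₀).quasiMeasurePreserving.preimage_null h0
    filter_upwards [measure_eq_zero_iff_ae_notMem.1 h1] with z hz
    have h2 : x₀ - z ∉ frontier T := hz
    exact ContinuousAt.comp (f := fun x => x - z) (continuousAt_indicator_const h2 (f z))
      (by fun_prop)

theorem measurable_nikodymMaximal (hr : ∀ j, 0 < r j) {f : EuclideanSpace ℝ (Fin n) → ℂ}
    (hf : MemLp f 2 volume) : Measurable (nikodymMaximal e r f) := by
  -- The supremum is over uncountably many s, but a supremum of continuous functions is lower
  -- semicontinuous and hence Borel.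
  have h : LowerSemicontinuous fun x => ⨆ s ∈ Icc (-1 : ℝ) 1, ‖nikodymAverage e r f x s‖ₑ := by
    refine lowerSemicontinuous_biSup fun s _ => Continuous.lowerSemicontinuous ?_
    refine Continuous.enorm ?_
    simp only [nikodymAverage, setAverage_eq]
    exact (continuous_setIntegral_sub (isCompact_nikodymBox hr) (convex_nikodymBox hr)
      (hf.locallyIntegrable (by norm_num))).const_smul _
  exact h.measurable

end Measurability

/-! ### Dyadic nets of parameters and their size. -/

section DyadicNet

/-- The points `-1 + 2 k / 2 ^ L`, truncated at `1`. -/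
noncomputable def dyadicNet (L k : ℕ) : ℝ := min 1 (-1 + k * (2 / 2 ^ L))

theorem monotone_dyadicNet (L : ℕ) : Monotone (dyadicNet L) := fun i j hij => by
  unfold dyadicNet
  gcongr

theorem dyadicNet_mem_Icc (L k : ℕ) : dyadicNet L k ∈ Icc (-1 : ℝ) 1 := by
  refine ⟨le_min (by norm_num) ?_, min_le_left _ _⟩
  have : (0 : ℝ) ≤ k * (2 / 2 ^ L) := by positivity
  linarith

theorem exists_dyadicNet_near (L : ℕ) {s : ℝ} (hs : s ∈ Icc (-1 : ℝ) 1) :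
    ∃ k < 2 ^ L, |s - dyadicNet L k| ≤ 2 / 2 ^ L := by
  have hpos : (0 : ℝ) < 2 ^ L := by positivity
  set d : ℝ := 2 / 2 ^ L with hd
  have hd0 : 0 < d := by positivity
  have hdL : d * 2 ^ L = 2 := by rw [hd]; field_simp
  rcases hs.2.lt_or_eq with h | h
  · set m : ℕ := ⌊(s + 1) / d⌋₊ with hm
    have h0 : 0 ≤ (s + 1) / d := div_nonneg (by linarith [hs.1]) hd0.le
    have h1 : (m : ℝ) * d ≤ s + 1 := by
      rw [← le_div_iff₀ hd0]
      exact Nat.floor_le h0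
    have h2 : s + 1 < (m + 1) * d := by
      rw [← div_lt_iff₀ hd0]
      exact Nat.lt_floor_add_one _
    refine ⟨m, ?_, ?_⟩
    · have h3 : (m : ℝ) < 2 ^ L := by
        by_contra hc
        have := mul_le_mul_of_nonneg_left (not_lt.1 hc) hd0.le
        nlinarith
      exact_mod_cast h3
    · rw [dyadicNet, ← hd, min_eq_right (by linarith), abs_le]
      constructor <;> linarith
  -- At s = 1 rounding down would give the index 2^L, which is out of range; the last admissible
  -- point is one mesh length away.
  · refine ⟨2 ^ L - 1, by have := Nat.two_pow_pos L; omega, ?_⟩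
    rw [dyadicNet, ← hd, Nat.cast_sub Nat.one_le_two_pow, h]
    push_cast
    rw [min_eq_right (by linarith), abs_le]
    constructor <;> linarith

/-- A mesh of size η/x needs only L ~ log₂(x/η), and the logarithm is absorbed by x^δ. -/
theorem exists_dyadic_level_le {η δ : ℝ} (hη : 0 < η) (hη1 : η ≤ 1) (hδ : 0 < δ) :
    ∃ C : ℝ, 0 < C ∧ ∀ x : ℝ, 1 ≤ x → ∃ L : ℕ, 2 / 2 ^ L ≤ η / x ∧ (L + 1 : ℝ) ≤ C * x ^ δ := by
  have hlog2 : 0 < Real.log 2 := Real.log_pos (by norm_num)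
  refine ⟨(2 / η) ^ δ / δ / Real.log 2 + 2, by positivity, fun x hx => ?_⟩
  have hx0 : 0 < x := by linarith
  set y : ℝ := 2 / η * x with hy
  have hy1 : 1 ≤ y := by
    refine one_le_mul_of_one_le_of_one_le ?_ hx
    rw [one_le_div hη]
    linarith
  refine ⟨⌈Real.logb 2 y⌉₊, ?_, ?_⟩
  · have h1 : y ≤ 2 ^ ⌈Real.logb 2 y⌉₊ := by
      rw [← Real.rpow_natCast, ← Real.logb_le_iff_le_rpow (by norm_num) (by linarith)]
      exact Nat.le_ceil _
    rw [div_le_div_iff₀ (by positivity) hx0]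
    have h2 : y * η = 2 * x := by rw [hy]; field_simp
    rw [← h2, mul_comm]
    gcongr
  · have h1 := (Nat.ceil_lt_add_one (Real.logb_nonneg (by norm_num : (1 : ℝ) < 2) hy1)).le
    have h2 : Real.logb 2 y ≤ (2 / η) ^ δ / δ / Real.log 2 * x ^ δ := by
      rw [Real.logb]
      calc Real.log y / Real.log 2 ≤ (y ^ δ / δ) / Real.log 2 := by
            gcongr
            exact Real.log_le_rpow_div (by linarith) hδ
        _ = _ := by
            rw [hy, Real.mul_rpow (by positivity) hx0.le]
            ring
    have h3 : 1 ≤ x ^ δ := Real.one_le_rpow hx hδ.le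
    linarith

end DyadicNet

/-! ### Assembling the L² estimate. -/

section MainBound

open scoped FourierTransform

variable {n : ℕ} {e : Fin n → ℝ → EuclideanSpace ℝ (Fin n)} {r : Fin n → ℝ}

/-- Bound for the maximal function of Gaussian averages over a dyadic net of parameters. -/
theorem lintegral_iSup_gaussian_le {B : ℕ → EuclideanSpace ℝ (Fin n) ≃L[ℝ] EuclideanSpace ℝ (Fin n)}
    {L : ℕ} (hB : ∀ k, (B k : EuclideanSpace ℝ (Fin n) →L[ℝ] EuclideanSpace ℝ (Fin n)) =
      boxMap e r (dyadicNet L k)) {A : ℝ} (hA : 1 ≤ A)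
    (hvar : ∀ ξ, eVariationOn (fun s => Real.exp (-(Real.pi *
        ‖ContinuousLinearMap.adjoint (boxMap e r s) ξ‖ ^ 2))) (Icc (-1) 1) ≤ ENNReal.ofReal A)
    {f : EuclideanSpace ℝ (Fin n) → ℂ} (hf : MemLp f 2 volume) :
    ∫⁻ x, ⨆ k ∈ Finset.range (2 ^ L), ‖∫ y, (gaussianKernel (B k) y : ℂ) * f (x - y)‖ₑ ^ 2 ≤
      ENNReal.ofReal (((L + 1) * A) ^ 2) * eLpNorm f 2 volume ^ 2 := by
  have hF : ∀ k ξ, 𝓕 (fun y => (gaussianKernel (B k) y : ℂ)) ξ = (Real.exp (-(Real.pi *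
      ‖ContinuousLinearMap.adjoint (boxMap e r (dyadicNet L k)) ξ‖ ^ 2)) : ℂ) := by
    intro k ξ
    rw [fourier_gaussianKernel, hB, neg_mul]
  refine lintegral_iSup_convolution_le L (fun k => integrable_gaussianKernel (B k))
    (fun k => memLp_two_gaussianKernel (B k)) hA (fun ξ => ?_) (fun ξ l hl => ?_) hf
  · rw [hF, Complex.norm_real, Real.norm_of_nonneg (Real.exp_pos _).le, Real.exp_le_one_iff]
    have := Real.pi_pos
    have h : 0 ≤ Real.pi * ‖ContinuousLinearMap.adjoint (boxMap e r (dyadicNet L 0)) ξ‖ ^ 2 := by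
      positivity
    linarith
  · have h1 := (eVariationOn.sum_le (f := fun s => Real.exp (-(Real.pi *
        ‖ContinuousLinearMap.adjoint (boxMap e r s) ξ‖ ^ 2))) (n := 2 ^ (L - l))
        (u := fun j => dyadicNet L (j * 2 ^ l))
        ((monotone_dyadicNet L).comp fun i j hij => Nat.mul_le_mul_right _ hij)
        fun i => dyadicNet_mem_Icc L _).trans (hvar ξ)
    simp only [hF, ← Complex.ofReal_sub, Complex.norm_real]
    simp only [edist_dist, dist_eq_norm] at h1
    rw [← ENNReal.ofReal_sum_of_nonneg fun _ _ => norm_nonneg _,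
      ENNReal.ofReal_le_ofReal_iff (by linarith)] at h1
    exact h1

theorem lintegral_nikodymMaximal_sq_le (he : IsNondegenerateFrame e) {ε : ℝ} (hε : 0 < ε) :
    ∃ C : ℝ, 0 < C ∧ ∀ (r : Fin n → ℝ) (ρ R : ℝ), 0 < ρ → ρ ≤ R → (∀ j, ρ ≤ r j) →
      (∀ j, r j ≤ R) → ∀ f : EuclideanSpace ℝ (Fin n) → ℂ, MemLp f 2 volume →
        ∫⁻ x, nikodymMaximal e r f x ^ 2 ≤
          (ENNReal.ofReal (C * (R / ρ) ^ ε) * eLpNorm f 2 volume) ^ 2 := by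
  -- Half of the exponent ε is spent on the variation and half on the number of dyadic levels.
  obtain ⟨A, hA, hvar⟩ := exists_eVariationOn_multiplier_le he (half_pos hε)
  obtain ⟨η, C₀, hη, hη1, hC₀, hdom⟩ := exists_inv_volume_le_gaussianKernel he
  obtain ⟨C₁, hC₁, hlevel⟩ := exists_dyadic_level_le hη hη1 (half_pos hε)
  refine ⟨C₀ * (C₁ * A), by positivity, fun r ρ R hρ hρR hrρ hrR f hf => ?_⟩
  have hr : ∀ j, 0 < r j := fun j => hρ.trans_le (hrρ j)
  set x : ℝ := R / ρ with hx
  have hx1 : 1 ≤ x := (one_le_div hρ).2 hρR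
  have hxε : 1 ≤ x ^ (ε / 2) := Real.one_le_rpow hx1 (half_pos hε).le
  obtain ⟨L, hL, hLle⟩ := hlevel x hx1
  choose B hB using fun k => exists_boxEquiv he hr (dyadicNet_mem_Icc L k)
  -- Pointwise domination of kernels needs a nonnegative function, and replacing f by |f| does not
  -- change the L² norm.
  set F : EuclideanSpace ℝ (Fin n) → ℂ := fun y => (‖f y‖ : ℂ) with hF
  have hFm : MemLp F 2 volume := hf.norm.ofReal
  have hFn : eLpNorm F 2 volume = eLpNorm f 2 volume :=
    eLpNorm_congr_norm_ae (.of_forall fun y => by simp [hF])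
  have hmain := lintegral_iSup_gaussian_le hB (one_le_mul_of_one_le_of_one_le hA hxε)
    (hvar r ρ R hρ hρR hrρ hrR) hFm
  set S : EuclideanSpace ℝ (Fin n) → ℝ≥0∞ := fun x =>
    ⨆ k ∈ Finset.range (2 ^ L), ‖∫ y, (gaussianKernel (B k) y : ℂ) * F (x - y)‖ₑ ^ 2 with hS
  have hpt : ∀ z, nikodymMaximal e r f z ^ 2 ≤ ENNReal.ofReal C₀ ^ 2 * S z := by
    intro z
    have h1 : nikodymMaximal e r f z ≤ ENNReal.ofReal C₀ * S z ^ (1 / 2 : ℝ) := by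
      refine iSup₂_le fun s hs => ?_
      obtain ⟨k, hk, hks⟩ := exists_dyadicNet_near L hs
      have h2 := enorm_nikodymAverage_le hf (gaussianKernel_nonneg (B k))
        (memLp_two_gaussianKernel (B k)) hC₀ hr (hdom r ρ R hρ hρR hrρ hrR s hs _
          (dyadicNet_mem_Icc L k) (hks.trans hL) (B k) (hB k)) z
      refine h2.trans ?_
      gcongr
      have h3 : ‖∫ y, (gaussianKernel (B k) y : ℂ) * F (z - y)‖ₑ ^ 2 ≤ S z :=
        le_iSup₂_of_le (f := fun k (_ : k ∈ Finset.range (2 ^ L)) =>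
          ‖∫ y, (gaussianKernel (B k) y : ℂ) * F (z - y)‖ₑ ^ 2) k (Finset.mem_range.2 hk) le_rfl
      refine le_trans (le_of_eq ?_) (ENNReal.rpow_le_rpow h3 (by norm_num : (0 : ℝ) ≤ 1 / 2))
      rw [← ENNReal.rpow_natCast, ← ENNReal.rpow_mul]
      norm_num [hF]
    refine (pow_le_pow_left₀ zero_le h1 2).trans (le_of_eq ?_)
    rw [mul_pow, ← ENNReal.rpow_natCast (S z ^ (1 / 2 : ℝ)), ← ENNReal.rpow_mul]
    norm_num
  calc ∫⁻ z, nikodymMaximal e r f z ^ 2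
      ≤ ∫⁻ z, ENNReal.ofReal C₀ ^ 2 * S z := lintegral_mono hpt
    _ = ENNReal.ofReal C₀ ^ 2 * ∫⁻ z, S z :=
        lintegral_const_mul' _ _ (ENNReal.pow_ne_top ENNReal.ofReal_ne_top)
    _ ≤ ENNReal.ofReal C₀ ^ 2 * (ENNReal.ofReal (((L + 1) * (A * x ^ (ε / 2))) ^ 2) *
        eLpNorm f 2 volume ^ 2) := by
        rw [← hFn]
        gcongr
    _ ≤ _ := by
        rw [ENNReal.ofReal_pow (by positivity), ← mul_assoc, ← mul_pow, ← mul_pow,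
          ← ENNReal.ofReal_mul hC₀.le]
        have hc : C₀ * ((L + 1) * (A * x ^ (ε / 2))) ≤ C₀ * (C₁ * A) * x ^ ε :=
          calc C₀ * ((L + 1) * (A * x ^ (ε / 2)))
              ≤ C₀ * ((C₁ * x ^ (ε / 2)) * (A * x ^ (ε / 2))) := by gcongr
            _ = C₀ * (C₁ * A) * (x ^ (ε / 2) * x ^ (ε / 2)) := by ring
            _ = _ := by rw [← Real.rpow_add (by linarith), add_halves]
        have hc' := ENNReal.ofReal_le_ofReal hc
        gcongr

end MainBound

theorem mainTheorem10 (n : ℕ) (hn : 1 ≤ n) (e : Fin n → ℝ → EuclideanSpace ℝ (Fin n))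
    (he : IsNondegenerateFrame e) (ε : ℝ) (hε : 0 < ε) :
    ∃ C : ℝ, 0 < C ∧ ∀ r : Fin n → ℝ, (∀ j, 0 < r j) →
      ∀ f : EuclideanSpace ℝ (Fin n) → ℂ, MemLp f 2 volume →
        MemLp (nikodymMaximal e r f) 2 volume ∧
        eLpNorm (nikodymMaximal e r f) 2 volume ≤
          ENNReal.ofReal (C * eccentricity r ^ ε) * eLpNorm f 2 volume := by
  obtain ⟨C, hC, hmain⟩ := lintegral_nikodymMaximal_sq_le he hε
  refine ⟨C, hC, fun r hr f hf => ?_⟩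
  have : Nonempty (Fin n) := ⟨⟨0, hn⟩⟩
  have hρ : 0 < ⨅ j, r j := by
    obtain ⟨j, hj⟩ := exists_eq_ciInf_of_finite (f := r)
    exact hj ▸ hr j
  have hrρ : ∀ j, ⨅ j, r j ≤ r j := ciInf_le (finite_range r).bddBelow
  have hrR : ∀ j, r j ≤ ⨆ j, r j := le_ciSup (finite_range r).bddAbove
  have hρR : ⨅ j, r j ≤ ⨆ j, r j := (hrρ ⟨0, hn⟩).trans (hrR ⟨0, hn⟩)
  have h1 := hmain r _ _ hρ hρR hrρ hrR f hf
  have hsq : eLpNorm (nikodymMaximal e r f) 2 volume ^ 2 = ∫⁻ x, nikodymMaximal e r f x ^ 2 := by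
    rw [eLpNorm_eq_lintegral_rpow_enorm_toReal (by norm_num) (by norm_num), ← ENNReal.rpow_natCast,
      ← ENNReal.rpow_mul]
    norm_num
  have hle : eLpNorm (nikodymMaximal e r f) 2 volume ≤
      ENNReal.ofReal (C * eccentricity r ^ ε) * eLpNorm f 2 volume := by
    rw [← hsq] at h1
    exact (ENNReal.pow_le_pow_left_iff two_ne_zero).1 h1
  exact ⟨⟨(measurable_nikodymMaximal hr hf).aestronglyMeasurable,
    hle.trans_lt (ENNReal.mul_lt_top ENNReal.ofReal_lt_top hf.2)⟩, hle⟩
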